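/- Let $F$ be a field, let $N\ge 2$ be an even integer, let $\mathcal W=\{w_{i,k,j}: 1\le i,k,j\le N\}$ be distinct indeterminates, and let $\mathbb G=F(\mathcal W)$. For integers $i,j$ put $[i,j]=\{k\in\mathbb Z: i\le k\le j\}$. For $|[i,j]|$ even define $g_{i,j}\in\mathbb G[x_1,\dots,x_N]$ by $g_{i,j}=1$ if $[i,j]=\emptyset$, and otherwise $$g_{i,j}=(1+x_ix_j)\,g_{i+1,j-1}+\sum_{k} w_{i,k,j}\,g_{i,k}\,g_{k+1,j},$$ where $k$ ranges over those elements of $[i+1,j-2]$ for which $|[i,k]|$ is even. Let $g=g_{1,N}$ (the Raz–Yehudayoff polynomial). An algebraic branching program (ABP) over $\mathbb G$ is a finite layered directed graph whose edges go from a layer to the next one and are labelled by a variable $x_i$ or a constant of $\mathbb G$, with a start node in the first layer and a terminal node in the last one; it computes the sum, over all paths from the start to the terminal node, of the products of the edge labels. Its size is its number of nodes. An $r$-pass multilinear ABP is an ABP such that (i) for every layer at most one variable labels the edges leaving it, (ii) every variable occurs at most once on every path from the start to the terminal node, and (iii) there are permutations $\pi_1,\dots,\pi_r$ of $\{1,\dots,N\}$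 such that the sequence of the variables read by the successive non-constant layers is a subsequence of $$x_{\pi_1(1)},\dots,x_{\pi_1(N)},\ \dots,\ x_{\pi_r(1)},\dots,x_{\pi_r(N)}.$$ **Theorem.** There are absolute constants $\varepsilon>0$ and $c>0$ such that for every field $F$, every even $N\ge 2$ and all $r,s,m$: if $g=f_1+\dots+f_m$, where each $f_j\in\mathbb G[x_1,\dots,x_N]$ is computed by an $r$-pass multilinear ABP of size at most $s$, then $$m\ \ge\ \frac{2^{\varepsilon N^{1/5}}}{s^{\,c\,(r+\log_2 N)}}.$$ -/

import Mathlib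

/-- A (layered) algebraic branching program over the variables `σ` and the field `K`.
The nodes are `Fin size`, distributed over the layers `0, …, len`; every edge goes from some layer
to the next one and is labelled by a variable or by a constant.  Parallel edges are allowed. -/
structure ABP (σ K : Type*) where
  /-- the number of nodes -/
  size : ℕ
  /-- the index of the last layer -/
  len : ℕ
  /-- the number of edges -/
  numEdges : ℕ
  layer : Fin size → Fin (len + 1)
  src : Fin numEdges → Fin size
  tgt : Fin numEdges → Fin size
  label : Fin numEdges → σ ⊕ K
  layer_tgt : ∀ e, (layer (tgt e) : ℕ) = layer (src e) + 1
  /-- the start node -/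
  start : Fin size
  /-- the terminal node -/
  term : Fin size
  layer_start : layer start = 0
  layer_term : layer term = Fin.last len

namespace ABP

/-- The nodes `u 0, …, u len` and the edges `e 0, …, e (len - 1)` form a path from the start node
to the terminal node. -/
def IsPath {σ K : Type*} (P : ABP σ K) (u : Fin (P.len + 1) → Fin P.size)
    (e : Fin P.len → Fin P.numEdges) : Prop :=
  u 0 = P.start ∧ u (Fin.last P.len) = P.term ∧
    ∀ i : Fin P.len, P.src (e i) = u i.castSucc ∧ P.tgt (e i) = u i.succ

/-- The label of an edge, as a polynomial. -/
noncomputable def edgePoly {σ K : Type*} [Field K] (P : ABP σ K) (e : Fin P.numEdges) :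
    MvPolynomial σ K :=
  Sum.elim MvPolynomial.X MvPolynomial.C (P.label e)

open Classical in
/-- The polynomial computed by `P`: the sum, over all paths from the start node to the terminal
node, of the product of the edge labels. -/
noncomputable def poly {σ K : Type*} [Field K] (P : ABP σ K) : MvPolynomial σ K :=
  ∑ p : (Fin (P.len + 1) → Fin P.size) × (Fin P.len → Fin P.numEdges) with P.IsPath p.1 p.2,
    ∏ i, P.edgePoly (p.2 i)

/-- Every variable occurs at most once on every path from the start to the terminal node. -/
def IsSyntacticMultilinear {σ K : Type*} (P : ABP σ K) : Prop :=
  ∀ u e, P.IsPath u e → ∀ (x : σ) (i i' : Fin P.len),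
    P.label (e i) = Sum.inl x → P.label (e i') = Sum.inl x → i = i'

/-- `v` lists, layer by layer, the only variable that may label the edges leaving that layer
(`none` for a layer whose outgoing edges are all labelled by constants). -/
def Reads {σ K : Type*} (P : ABP σ K) (v : Fin P.len → Option σ) : Prop :=
  ∀ (i : Fin P.len) (e : Fin P.numEdges) (x : σ),
    P.layer (P.src e) = i.castSucc → P.label e = Sum.inl x → v i = some x

/-- For every layer there is at most one variable that labels edges from that layer. -/
def IsOblivious {σ K : Type*} (P : ABP σ K) : Prop :=
  ∃ v, P.Reads v

/-- `P` is an `r`-pass multilinear ABP: it is oblivious and syntactic multilinear, and there are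
permutations `π 0, …, π (r - 1)` such that the variables read by the successive non-constant layers
appear in the order `x_{π 0 (0)}, …, x_{π 0 (N-1)}, …, x_{π (r-1) (0)}, …, x_{π (r-1) (N-1)}`.
A pass may skip variables, so a `1`-pass multilinear ABP is the same as a read-once oblivious ABP,
in which every variable appears in at most one layer. -/
def IsRPassMultilinear {N : ℕ} {K : Type*} (r : ℕ) (P : ABP (Fin N) K) : Prop :=
  P.IsOblivious ∧ P.IsSyntacticMultilinear ∧
    ∃ (π : Fin r → Equiv.Perm (Fin N)) (v : Fin P.len → Option (Fin N)), P.Reads v ∧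
      (List.ofFn v).reduceOption.Sublist (List.ofFn fun a : Fin r => List.ofFn (π a)).flatten

end ABP

/-- The recursion of Raz and Yehudayoff, for given elements `x i` and `w i k j` of a ring:
`g_{i,j} = 1` if the interval `[i,j]` is empty, and otherwise
`g_{i,j} = (1 + x_i x_j) g_{i+1,j-1} + ∑ k, w_{i,k,j} g_{i,k} g_{k+1,j}`, where `k` ranges over
those elements of `[i+1,j-2]` for which `|[i,k]| = k + 1 - i` is even.
It is only meaningful for `1 ≤ i` and `|[i,j]|` even. -/
def razYehudayoffRec {R : Type*} [CommRing R] (x : ℕ → R) (w : ℕ → ℕ → ℕ → R) (i j : ℕ) : R :=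
  if j < i then 1
  else
    (1 + x i * x j) * razYehudayoffRec x w (i + 1) (j - 1) +
      ∑ k : {k // k ∈ (Finset.Icc (i + 1) (j - 2)).filter fun k => Even (k + 1 - i)},
        w i k j * razYehudayoffRec x w i k * razYehudayoffRec x w (k + 1) j
termination_by j + 1 - i
decreasing_by
  · omega
  · have := k.2
    simp only [Finset.mem_filter, Finset.mem_Icc] at this
    omega
  · have := k.2
    simp only [Finset.mem_filter, Finset.mem_Icc] at this
    omega

theorem razYehudayoffRec_of_lt {R : Type*} [CommRing R] (x : ℕ → R) (w : ℕ → ℕ → ℕ → R)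
    {i j : ℕ} (h : j < i) : razYehudayoffRec x w i j = 1 := by
  rw [razYehudayoffRec, if_pos h]

theorem razYehudayoffRec_of_le {R : Type*} [CommRing R] (x : ℕ → R) (w : ℕ → ℕ → ℕ → R)
    {i j : ℕ} (h : i ≤ j) : razYehudayoffRec x w i j =
      (1 + x i * x j) * razYehudayoffRec x w (i + 1) (j - 1) +
        ∑ k ∈ Finset.Icc (i + 1) (j - 2) with Even (k + 1 - i),
          w i k j * razYehudayoffRec x w i k * razYehudayoffRec x w (k + 1) j := by
  rw [razYehudayoffRec, if_neg (not_lt.mpr h)]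
  congr 1
  exact Finset.sum_coe_sort ((Finset.Icc (i + 1) (j - 2)).filter fun k => Even (k + 1 - i))
    (fun k => w i k j * razYehudayoffRec x w i k * razYehudayoffRec x w (k + 1) j)

/-- The rational function field `F(W)`, `W = {w_{i,k,j} : i, k, j ∈ [N]}`. -/
abbrev RYField (F : Type*) [Field F] (N : ℕ) : Type _ :=
  FractionRing (MvPolynomial (Fin N × Fin N × Fin N) F)

/-- The variable `x_i`, `1 ≤ i ≤ N`. -/
noncomputable def ryX (F : Type*) [Field F] (N i : ℕ) : MvPolynomial (Fin N) (RYField F N) :=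
  if h : 1 ≤ i ∧ i ≤ N then MvPolynomial.X ⟨i - 1, by omega⟩ else 0

/-- The element `w_{i,k,j}` of `F(W)`, `1 ≤ i, k, j ≤ N`, as a constant polynomial. -/
noncomputable def ryW (F : Type*) [Field F] (N i k j : ℕ) : MvPolynomial (Fin N) (RYField F N) :=
  if h : (1 ≤ i ∧ i ≤ N) ∧ (1 ≤ k ∧ k ≤ N) ∧ (1 ≤ j ∧ j ≤ N) then
    MvPolynomial.C (algebraMap (MvPolynomial (Fin N × Fin N × Fin N) F) (RYField F N)
      (MvPolynomial.X (⟨i - 1, by omega⟩, ⟨k - 1, by omega⟩, ⟨j - 1, by omega⟩)))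
  else 0

/-- The Raz–Yehudayoff polynomial `g = g_{1,N}` in `F(W)[x_1, …, x_N]`. -/
noncomputable def razYehudayoff (F : Type*) [Field F] (N : ℕ) :
    MvPolynomial (Fin N) (RYField F N) :=
  razYehudayoffRec (ryX F N) (ryW F N) 1 N

/-!
Evaluated at the points of the Boolean cube, a polynomial in `N` variables becomes, for every set
`S` of variables, a matrix with rows indexed by the values of the variables in `S` and columns by
those of the others. If `#S = N / 2`, the matrix of `g` has full rank `2 ^ (N / 2)`. Indeed, it
suffices to find one specialization of the weights `w_{i,k,j}` with this property. If exactly one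
of `i`, `j` lies in `S`, the factor `1 + x_i x_j` is nonsingular, and the weights can be chosen so
as to leave only `(1 + x_i x_j) g_{i+1,j-1}`. Otherwise some proper prefix `[i,k]` of `[i,j]` is
balanced, and for all but finitely many values of `w_{i,k,j}` the product `g_{i,k} g_{k+1,j}`
dominates.

On the other hand, fixing the nodes of an `r`-pass ABP of size `s` at the `r` layers where a pass
ends writes it as a sum of `s ^ r` read-once programs, each with its own order of the variables.
Cutting such an order into `q` blocks of `256 h ^ 2` variables and a remainder, one sees that the
rank of a read-once program is at most `s ^ (q + 1)` times the product over the blocks of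
`2 ^ (the size of the smaller part into which S divides the block)`. For a random `S` a block is
typically off balance by about `h`, so that with probability at least `1 - 2 ^ (-q)` the rank is at
most `s ^ (q + 1) * 2 ^ (N / 2 - q * h)`. With `h` about `log₂ s` this is far below `2 ^ (N / 2)`,
and a union bound gives an `S` that works for all read-once programs at once unless there are about
`2 ^ q / N` of them.
-/

section SplitRank

open Finset

/-- `h` is a sum of at most `T` products of a function of the coordinates in `S` and a function
of the coordinates outside `S`. Points of the cube are encoded by their supports, so `h` is a
function of finite sets. -/
def HasSplitRank {α K : Type*} [DecidableEq α] [CommSemiring K] (S : Finset α) (T : ℕ)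
    (h : Finset α → K) : Prop :=
  ∃ a b : Fin T → Finset α → K, ∀ A, h A = ∑ t, a t (A ∩ S) * b t (A \ S)

namespace HasSplitRank

variable {α K : Type*} [DecidableEq α] [CommSemiring K] {S : Finset α}

theorem of_fintype {ι : Type*} [Fintype ι] {h : Finset α → K} (a b : ι → Finset α → K)
    (hab : ∀ A, h A = ∑ t, a t (A ∩ S) * b t (A \ S)) : HasSplitRank S (Fintype.card ι) h :=
  let e := (Fintype.equivFin ι).symm
  ⟨fun t => a (e t), fun t => b (e t), fun A => by
    rw [hab, ← e.sum_comp]⟩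

theorem of_powerset {D : Finset α} {h : Finset α → K} (a b : Finset α → Finset α → K)
    (hab : ∀ A, h A = ∑ C ∈ D.powerset, a C (A ∩ S) * b C (A \ S)) :
    HasSplitRank S (2 ^ #D) h := by
  have hcard : Fintype.card D.powerset = 2 ^ #D := by rw [Fintype.card_coe, card_powerset]
  rw [← hcard]
  exact of_fintype (fun C : D.powerset => a C) (fun C => b C) fun A => by
    rw [hab, ← sum_coe_sort]

theorem mono {T T' : ℕ} {h : Finset α → K} (hT : T ≤ T') (hh : HasSplitRank S T h) :
    HasSplitRank S T' h := by
  obtain ⟨a, b, hab⟩ := hh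
  obtain ⟨d, rfl⟩ := Nat.exists_eq_add_of_le hT
  refine ⟨Fin.append a 0, Fin.append b 0, fun A => ?_⟩
  simp [Fin.sum_univ_add, hab]

theorem sum {ι : Type*} [Fintype ι] {T : ι → ℕ} {h : ι → Finset α → K}
    (hh : ∀ i, HasSplitRank S (T i) (h i)) :
    HasSplitRank S (∑ i, T i) fun A => ∑ i, h i A := by
  choose a b hab using hh
  have hcard : Fintype.card (Σ i, Fin (T i)) = ∑ i, T i := by simp
  rw [← hcard]
  refine of_fintype (fun p => a p.1 p.2) (fun p => b p.1 p.2) fun A => ?_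
  rw [Fintype.sum_sigma]
  exact Finset.sum_congr rfl fun i _ => hab i A

theorem sum_const {ι : Type*} [Fintype ι] {T : ℕ} {h : ι → Finset α → K}
    (hh : ∀ i, HasSplitRank S T (h i)) :
    HasSplitRank S (Fintype.card ι * T) fun A => ∑ i, h i A := by
  simpa using sum hh

theorem mul {T T' : ℕ} {h h' : Finset α → K} (hh : HasSplitRank S T h)
    (hh' : HasSplitRank S T' h') : HasSplitRank S (T * T') fun A => h A * h' A := by
  obtain ⟨a, b, hab⟩ := hh
  obtain ⟨a', b', hab'⟩ := hh'
  have hcard : Fintype.card (Fin T × Fin T') = T * T' := by simp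
  rw [← hcard]
  refine of_fintype (fun p A => a p.1 A * a' p.2 A) (fun p A => b p.1 A * b' p.2 A) fun A => ?_
  rw [hab, hab', Finset.sum_mul_sum, Fintype.sum_prod_type]
  simp only [mul_mul_mul_comm]

theorem const (c : K) : HasSplitRank S 1 fun _ => c :=
  ⟨fun _ _ => c, fun _ _ => 1, fun _ => by simp⟩

theorem of_dependsOn {B : Finset α} {h : Finset α → K} (hB : ∀ A, h A = h (A ∩ B)) :
    HasSplitRank S (2 ^ min #(B ∩ S) #(B \ S)) h := by
  have inter_eq_union (A : Finset α) : A ∩ B = A ∩ S ∩ B ∪ A \ S ∩ B := by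
    rw [← union_inter_distrib_right, union_comm, sdiff_union_inter]
  rcases min_choice #(B ∩ S) #(B \ S) with hmin | hmin <;> rw [hmin]
  · refine of_powerset (fun C A => if A ∩ B = C then 1 else 0) (fun C A => h (C ∪ A ∩ B))
      fun A => ?_
    have hmem : A ∩ S ∩ B ∈ (B ∩ S).powerset :=
      mem_powerset.2 fun x hx => by simp only [mem_inter] at hx ⊢; tauto
    simp only [ite_mul, one_mul, zero_mul, sum_ite_eq, if_pos hmem]
    rw [hB A, inter_eq_union A]
  · refine of_powerset (fun C A => h (A ∩ B ∪ C)) (fun C A => if A ∩ B = C then 1 else 0)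
      fun A => ?_
    have hmem : A \ S ∩ B ∈ (B \ S).powerset :=
      mem_powerset.2 fun x hx => by simp only [mem_inter, mem_sdiff] at hx ⊢; tauto
    simp only [mul_ite, mul_one, mul_zero, sum_ite_eq, if_pos hmem]
    rw [hB A, inter_eq_union A]

theorem map {β : Type*} [DecidableEq β] {T : ℕ} {h : Finset α → K} (hh : HasSplitRank S T h)
    (e : α ↪ β) :
    HasSplitRank (S.map e) T fun A => h (A.preimage e e.injective.injOn) := by
  obtain ⟨a, b, hab⟩ := hh
  refine ⟨fun t A => a t (A.preimage e e.injective.injOn),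
    fun t A => b t (A.preimage e e.injective.injOn), fun A => ?_⟩
  have preimage_inter_map : (A ∩ S.map e).preimage e e.injective.injOn =
      A.preimage e e.injective.injOn ∩ S := by ext; simp
  have preimage_sdiff_map : (A \ S.map e).preimage e e.injective.injOn =
      A.preimage e e.injective.injOn \ S := by ext; simp
  simp only [preimage_inter_map, preimage_sdiff_map, hab]

end HasSplitRank

theorem union_inter_of_disjoint {α : Type*} [DecidableEq α] {s t B C : Finset α}
    (hst : Disjoint s t) (hB : B ⊆ s) (hC : C ⊆ t) : (B ∪ C) ∩ s = B := by
  rw [union_inter_distrib_right, inter_eq_left.2 hB,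
    disjoint_iff_inter_eq_empty.1 (hst.symm.mono_left hC), union_empty]

theorem sum_powerset_union {α M : Type*} [DecidableEq α] [AddCommMonoid M] {s t : Finset α}
    (hst : Disjoint s t) (f : Finset α → M) :
    ∑ A ∈ (s ∪ t).powerset, f A = ∑ B ∈ s.powerset, ∑ C ∈ t.powerset, f (B ∪ C) := by
  rw [← sum_product']
  refine sum_bij' (fun A _ => (A ∩ s, A ∩ t)) (fun p _ => p.1 ∪ p.2) ?_ ?_ ?_ ?_ ?_ <;>
    simp only [mem_product, mem_powerset, Prod.forall, and_imp, ← inter_union_distrib_left]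
  · exact fun A _ => ⟨inter_subset_right, inter_subset_right⟩
  · exact fun B C hB hC => union_subset_union hB hC
  · exact fun A hA => inter_eq_left.2 hA
  · exact fun B C hB hC => Prod.ext (union_inter_of_disjoint hst hB hC)
      (by rw [union_comm]; exact union_inter_of_disjoint hst.symm hC hB)
  · exact fun A hA => by rw [inter_eq_left.2 hA]

/-- The points of the ground set `s` split into those in `S` and those outside `S`; the matrix
`(h (A ∪ B))`, with rows `A ⊆ s ∩ S` and columns `B ⊆ s \ S`, has trivial kernel. -/
def NondegenerateOn {α K : Type*} [DecidableEq α] [CommSemiring K] (S s : Finset α)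
    (h : Finset α → K) : Prop :=
  ∀ u : Finset α → K, (∀ A ⊆ s ∩ S, ∑ B ∈ (s \ S).powerset, h (A ∪ B) * u B = 0) →
    ∀ B ⊆ s \ S, u B = 0

/-- The matrix `(h (A ∪ B))` of `NondegenerateOn`, its rows being indexed by means of `e` so that
it becomes square. -/
def splitMatrix {α K : Type*} [DecidableEq α] {S s : Finset α}
    (e : (s \ S).powerset ≃ (s ∩ S).powerset) (h : Finset α → K) :
    Matrix (s \ S).powerset (s \ S).powerset K :=
  Matrix.of fun A B => h (e A ∪ B)

theorem map_splitMatrix {α K K' : Type*} [DecidableEq α] [CommRing K] [CommRing K']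
    {S s : Finset α} (e : (s \ S).powerset ≃ (s ∩ S).powerset) (φ : K →+* K')
    (h : Finset α → K) :
    φ.mapMatrix (splitMatrix e h) = splitMatrix e fun A => φ (h A) :=
  rfl

theorem exists_extend {α K : Type*} [Zero K] {s : Finset α} (v : s → K) :
    ∃ u : α → K, (fun x : s => u x) = v :=
  ⟨Function.extend Subtype.val v 0, funext fun x => Subtype.val_injective.extend_apply v 0 x⟩

theorem nonempty_powerset_equiv {α β : Type*} {s : Finset α} {t : Finset β} (h : #s = #t) :
    Nonempty (s.powerset ≃ t.powerset) :=
  ⟨Fintype.equivOfCardEq (by simp [h])⟩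

namespace NondegenerateOn

variable {α K : Type*} [DecidableEq α] {S s : Finset α}

theorem iff_det_splitMatrix_ne_zero [CommRing K] [IsDomain K] {h : Finset α → K}
    (e : (s \ S).powerset ≃ (s ∩ S).powerset) :
    NondegenerateOn S s h ↔ (splitMatrix e h).det ≠ 0 := by
  have mulVec_apply (u : Finset α → K) (A : (s \ S).powerset) :
      (splitMatrix e h).mulVec (fun B => u B) A =
        ∑ B ∈ (s \ S).powerset, h (e A ∪ B) * u B := by
    rw [← sum_coe_sort]
    rfl
  rw [Ne, ← Matrix.exists_mulVec_eq_zero_iff]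
  constructor
  · rintro hh ⟨v, hv, hv0⟩
    obtain ⟨u, rfl⟩ := exists_extend v
    refine hv (funext fun B => hh u (fun A hA => ?_) B (mem_powerset.1 B.2))
    have hA0 := congrFun hv0 (e.symm ⟨A, mem_powerset.2 hA⟩)
    rwa [mulVec_apply, e.apply_symm_apply] at hA0
  · intro hh u hu B hB
    by_contra hne
    refine hh ⟨fun B => u B, fun h0 => hne (congrFun h0 ⟨B, mem_powerset.2 hB⟩), ?_⟩
    ext A
    rw [mulVec_apply]
    exact hu (e A) (mem_powerset.1 (e A).2)

theorem of_map {K' : Type*} [CommRing K] [IsDomain K] [CommRing K'] [IsDomain K']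
    (hs : #(s \ S) = #(s ∩ S)) (φ : K →+* K') {h : Finset α → K}
    (hh : NondegenerateOn S s fun A => φ (h A)) : NondegenerateOn S s h := by
  obtain ⟨e⟩ := nonempty_powerset_equiv hs
  rw [iff_det_splitMatrix_ne_zero e] at hh ⊢
  intro h0
  rw [← map_splitMatrix, ← RingHom.map_det, h0, map_zero] at hh
  exact hh rfl

theorem map {K' : Type*} [CommRing K] [IsDomain K] [CommRing K'] [IsDomain K']
    (hs : #(s \ S) = #(s ∩ S)) {φ : K →+* K'} (hφ : Function.Injective φ) {h : Finset α → K}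
    (hh : NondegenerateOn S s h) : NondegenerateOn S s fun A => φ (h A) := by
  obtain ⟨e⟩ := nonempty_powerset_equiv hs
  rw [iff_det_splitMatrix_ne_zero e] at hh ⊢
  rwa [← map_splitMatrix, ← RingHom.map_det, Ne, map_eq_zero_iff φ hφ]

/-- The determinant of `t * h + h'` is a polynomial in `t` whose leading coefficient is that
of `h`. -/
theorem exists_mul_add [CommRing K] [IsDomain K] [Infinite K] (hs : #(s \ S) = #(s ∩ S))
    {h : Finset α → K} (hh : NondegenerateOn S s h) (h' : Finset α → K) :
    ∃ t : K, NondegenerateOn S s fun A => t * h A + h' A := by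
  obtain ⟨e⟩ := nonempty_powerset_equiv hs
  rw [iff_det_splitMatrix_ne_zero e] at hh
  set p : Polynomial K := ((Polynomial.X : Polynomial K) • (splitMatrix e h).map Polynomial.C +
    (splitMatrix e h').map Polynomial.C).det with hp
  have hp0 : p ≠ 0 := by
    intro h0
    rw [← Polynomial.coeff_det_X_add_C_card _ (splitMatrix e h'), ← hp, h0,
      Polynomial.coeff_zero] at hh
    exact hh rfl
  obtain ⟨t, ht⟩ : ∃ t : K, p.eval t ≠ 0 := by
    by_contra! hcon
    exact hp0 (Polynomial.funext fun t => by rw [hcon t, Polynomial.eval_zero])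
  refine ⟨t, (iff_det_splitMatrix_ne_zero e).2 ?_⟩
  convert ht using 1
  rw [hp, ← Polynomial.coe_evalRingHom, RingHom.map_det]
  congr 1
  ext A B
  simp [splitMatrix, mul_comm t]

theorem mul [CommSemiring K] {s₁ s₂ : Finset α} {h₁ h₂ : Finset α → K}
    (hh₁ : NondegenerateOn S s₁ h₁) (hh₂ : NondegenerateOn S s₂ h₂) (hs : Disjoint s₁ s₂)
    (hdep₁ : ∀ A, h₁ A = h₁ (A ∩ s₁)) (hdep₂ : ∀ A, h₂ A = h₂ (A ∩ s₂)) :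
    NondegenerateOn S (s₁ ∪ s₂) fun A => h₁ A * h₂ A := by
  intro u hu
  simp only [union_sdiff_distrib, union_inter_distrib_right] at hu ⊢
  have partial_sum_eq_zero (A₂) (hA₂ : A₂ ⊆ s₂ ∩ S) : ∀ B₁ ⊆ s₁ \ S,
      ∑ B₂ ∈ (s₂ \ S).powerset, h₂ (A₂ ∪ B₂) * u (B₁ ∪ B₂) = 0 := by
    refine hh₁ (fun B₁ => ∑ B₂ ∈ (s₂ \ S).powerset, h₂ (A₂ ∪ B₂) * u (B₁ ∪ B₂)) fun A₁ hA₁ => ?_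
    rw [← hu (A₁ ∪ A₂) (union_subset_union hA₁ hA₂),
      sum_powerset_union (hs.mono sdiff_subset sdiff_subset)]
    refine sum_congr rfl fun B₁ hB₁ => ?_
    rw [mul_sum]
    refine sum_congr rfl fun B₂ hB₂ => ?_
    have h₁s : A₁ ∪ B₁ ⊆ s₁ := union_subset (hA₁.trans inter_subset_left)
      ((mem_powerset.1 hB₁).trans sdiff_subset)
    have h₂s : A₂ ∪ B₂ ⊆ s₂ := union_subset (hA₂.trans inter_subset_left)
      ((mem_powerset.1 hB₂).trans sdiff_subset)
    rw [union_union_union_comm, hdep₁ (_ ∪ _ ∪ _), union_inter_of_disjoint hs h₁s h₂s,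
      union_comm (A₁ ∪ B₁), hdep₂ (_ ∪ _ ∪ _), union_inter_of_disjoint hs.symm h₂s h₁s, mul_assoc]
  intro B hB
  rw [← inter_eq_left.2 hB, inter_union_distrib_left]
  exact hh₂ (fun B₂ => u (B ∩ (s₁ \ S) ∪ B₂))
    (fun A₂ hA₂ => partial_sum_eq_zero A₂ hA₂ _ inter_subset_right) _ inter_subset_right

theorem le_of_hasSplitRank [CommRing K] [Nontrivial K] {T : ℕ} {h : Finset α → K}
    (hh : NondegenerateOn S s h) (hT : HasSplitRank S T h) : 2 ^ #(s \ S) ≤ T := by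
  obtain ⟨a, b, hab⟩ := hT
  have split_union {A B : Finset α} (hA : A ⊆ s ∩ S) (hB : B ⊆ s \ S) :
      (A ∪ B) ∩ S = A ∧ (A ∪ B) \ S = B := by
    constructor <;> ext x <;> have := @hA x <;> have := @hB x <;>
      simp only [mem_inter, mem_union, mem_sdiff] at * <;> tauto
  let M : Matrix (Fin T) (s \ S).powerset K := Matrix.of fun t B => b t B
  have M_mulVec_apply (u : Finset α → K) (t : Fin T) :
      M.mulVec (fun B => u B) t = ∑ B ∈ (s \ S).powerset, b t B * u B := by
    rw [← sum_coe_sort]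
    rfl
  have ker_eq_bot : LinearMap.ker M.mulVecLin = ⊥ := by
    refine LinearMap.ker_eq_bot'.2 fun v hv => ?_
    obtain ⟨u, rfl⟩ := exists_extend v
    refine funext fun B => hh u (fun A hA => ?_) B (mem_powerset.1 B.2)
    calc ∑ B ∈ (s \ S).powerset, h (A ∪ B) * u B
        = ∑ B ∈ (s \ S).powerset, ∑ t, a t A * (b t B * u B) := by
          refine sum_congr rfl fun B hB => ?_
          obtain ⟨h₁, h₂⟩ := split_union hA (mem_powerset.1 hB)
          rw [hab, h₁, h₂, sum_mul]
          simp only [mul_assoc]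
      _ = ∑ t, a t A * M.mulVec (fun B => u B) t := by
          rw [sum_comm]
          simp only [M_mulVec_apply, mul_sum]
      _ = 0 := sum_eq_zero fun t _ => by
          rw [show M.mulVec _ t = 0 from congrFun hv t, mul_zero]
  simpa using LinearMap.finrank_le_finrank_of_injective (LinearMap.ker_eq_bot.1 ker_eq_bot)

end NondegenerateOn
end SplitRank

section RazYehudayoff

open Finset

theorem map_razYehudayoffRec {R R' : Type*} [CommRing R] [CommRing R'] (φ : R →+* R')
    (x : ℕ → R) (w : ℕ → ℕ → ℕ → R) (i j : ℕ) :
    φ (razYehudayoffRec x w i j) =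
      razYehudayoffRec (fun k => φ (x k)) (fun a b c => φ (w a b c)) i j := by
  induction hn : j + 1 - i using Nat.strong_induction_on generalizing i j with
  | _ n ih =>
    subst hn
    rcases lt_or_ge j i with h | h
    · rw [razYehudayoffRec_of_lt _ _ h, razYehudayoffRec_of_lt _ _ h, map_one]
    · simp only [razYehudayoffRec_of_le _ _ h, map_add, map_mul, map_one, map_sum]
      rw [ih _ (by omega) (i + 1) (j - 1) rfl]
      congr 1
      refine sum_congr rfl fun k hk => ?_
      simp only [mem_filter, mem_Icc] at hk
      rw [ih _ (by omega) i k rfl, ih _ (by omega) (k + 1) j rfl]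

theorem razYehudayoffRec_congr {R : Type*} [CommRing R] {x x' : ℕ → R} {w w' : ℕ → ℕ → ℕ → R}
    {i j : ℕ} (hx : ∀ k, i ≤ k → k ≤ j → x k = x' k)
    (hw : ∀ a b c, i ≤ a → a ≤ b → b ≤ c → c ≤ j → w a b c = w' a b c) :
    razYehudayoffRec x w i j = razYehudayoffRec x' w' i j := by
  induction hn : j + 1 - i using Nat.strong_induction_on generalizing i j with
  | _ n ih =>
    subst hn
    have rec_congr (i' j') (hi : i ≤ i') (hj : j' ≤ j) (hlt : j' + 1 - i' < j + 1 - i) :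
        razYehudayoffRec x w i' j' = razYehudayoffRec x' w' i' j' :=
      ih _ hlt (fun k h₁ h₂ => hx k (hi.trans h₁) (h₂.trans hj))
        (fun a b c h₁ h₂ h₃ h₄ => hw a b c (hi.trans h₁) h₂ h₃ (h₄.trans hj)) rfl
    rcases lt_or_ge j i with h | h
    · rw [razYehudayoffRec_of_lt _ _ h, razYehudayoffRec_of_lt _ _ h]
    · rw [razYehudayoffRec_of_le _ _ h, razYehudayoffRec_of_le _ _ h, hx i le_rfl h,
        hx j h le_rfl, rec_congr (i + 1) (j - 1) (by omega) (by omega) (by omega)]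
      congr 1
      refine sum_congr rfl fun k hk => ?_
      simp only [mem_filter, mem_Icc] at hk
      rw [hw i k j le_rfl (by omega) (by omega) le_rfl,
        rec_congr i k le_rfl (by omega) (by omega),
        rec_congr (k + 1) j (by omega) le_rfl (by omega)]

theorem exists_razYehudayoffRec_eq_outer {R : Type*} [CommRing R] {i j : ℕ} (hij : i ≤ j)
    (w : ℕ → ℕ → ℕ → R) : ∃ w' : ℕ → ℕ → ℕ → R, ∀ x, razYehudayoffRec x w' i j =
      (1 + x i * x j) * razYehudayoffRec x w (i + 1) (j - 1) := by
  refine ⟨fun a b c => if a = i then 0 else w a b c, fun x => ?_⟩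
  rw [razYehudayoffRec_of_le _ _ hij, sum_eq_zero fun k _ => by simp, add_zero]
  congr 1
  exact razYehudayoffRec_congr (fun _ _ _ => rfl) fun a b c ha _ _ _ => if_neg (by omega)

theorem exists_razYehudayoffRec_eq_split {R : Type*} [CommRing R] {i k j : ℕ} (hik : i < k)
    (hkj : k + 1 < j) (heven : Even (k + 1 - i)) (w₁ w₂ : ℕ → ℕ → ℕ → R) :
    ∃ (w₀ : ℕ → ℕ → ℕ → R) (w : R → ℕ → ℕ → ℕ → R), ∀ t x,
      razYehudayoffRec x (w t) i j =
        t * (razYehudayoffRec x w₁ i k * razYehudayoffRec x w₂ (k + 1) j) +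
          (1 + x i * x j) * razYehudayoffRec x w₀ (i + 1) (j - 1) := by
  let w₀ : ℕ → ℕ → ℕ → R := fun a b c => if c ≤ k then w₁ a b c else w₂ a b c
  let w : R → ℕ → ℕ → ℕ → R := fun t a b c =>
    if a = i ∧ c = j then (if b = k then t else 0) else w₀ a b c
  refine ⟨w₀, w, fun t x => ?_⟩
  have hk : k ∈ (Icc (i + 1) (j - 2)).filter fun k => Even (k + 1 - i) := by
    simp only [mem_filter, mem_Icc]
    exact ⟨by omega, heven⟩
  have w_self : w t i k j = t := by simp [w]
  have w_eq_w₁ : razYehudayoffRec x (w t) i k = razYehudayoffRec x w₁ i k :=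
    razYehudayoffRec_congr (fun _ _ _ => rfl) fun a b c _ _ _ _ =>
      (if_neg (by omega)).trans (if_pos (by omega))
  have w_eq_w₂ : razYehudayoffRec x (w t) (k + 1) j = razYehudayoffRec x w₂ (k + 1) j :=
    razYehudayoffRec_congr (fun _ _ _ => rfl) fun a b c _ _ _ _ =>
      (if_neg (by omega)).trans (if_neg (by omega))
  have w_eq_w₀ : razYehudayoffRec x (w t) (i + 1) (j - 1) =
      razYehudayoffRec x w₀ (i + 1) (j - 1) :=
    razYehudayoffRec_congr (fun _ _ _ => rfl) fun a b c _ _ _ _ => if_neg (by omega)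
  rw [razYehudayoffRec_of_le _ _ (by omega), sum_eq_single_of_mem k hk, w_self, w_eq_w₁,
    w_eq_w₂, w_eq_w₀, mul_assoc, add_comm]
  intro l _ hl
  simp [w, hl]

/-- The point of the Boolean cube with support `A`. -/
def zeroOne {α : Type*} [DecidableEq α] (K : Type*) [Zero K] [One K] (A : Finset α) (k : α) : K :=
  if k ∈ A then 1 else 0

theorem map_zeroOne {α R R' : Type*} [DecidableEq α] [NonAssocSemiring R] [NonAssocSemiring R']
    (φ : R →+* R') (A : Finset α) (k : α) : φ (zeroOne R A k) = zeroOne R' A k := by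
  unfold zeroOne
  split_ifs <;> simp

theorem razYehudayoffRec_zeroOne_inter {R : Type*} [CommRing R] (A : Finset ℕ)
    (w : ℕ → ℕ → ℕ → R) (i j : ℕ) : razYehudayoffRec (zeroOne R A) w i j =
      razYehudayoffRec (zeroOne R (A ∩ Icc i j)) w i j :=
  razYehudayoffRec_congr (fun k h₁ h₂ => by simp [zeroOne, h₁, h₂]) fun _ _ _ _ _ _ _ => rfl

theorem nondegenerateOn_one_add_mul {α K : Type*} [DecidableEq α] [CommRing K] {S : Finset α}
    {i j : α} (hi : i ∈ S) (hj : j ∉ S) :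
    NondegenerateOn S {i, j} fun A => 1 + zeroOne K A i * zeroOne K A j := by
  have hij : i ≠ j := ne_of_mem_of_not_mem hi hj
  have hinter : ({i, j} : Finset α) ∩ S = {i} := by ext; aesop
  have hsdiff : ({i, j} : Finset α) \ S = {j} := by ext; aesop
  have hpowerset : ({j} : Finset α).powerset = {∅, {j}} := by
    ext
    simp [subset_singleton_iff]
  intro u hu
  rw [hinter, hsdiff, hpowerset] at hu
  have row_empty := hu ∅ (by simp)
  have row_i := hu {i} subset_rfl
  rw [sum_pair (singleton_ne_empty j).symm] at row_empty row_i
  simp only [zeroOne, union_empty, empty_union, mem_singleton, notMem_empty, hij, hij.symm,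
    if_true, if_false, mem_union, or_false, or_true] at row_empty row_i
  have u_j : u {j} = 0 := by linear_combination row_i - row_empty
  have u_empty : u ∅ = 0 := by linear_combination row_empty - u_j
  intro B hB
  rw [hsdiff] at hB
  rcases subset_singleton_iff.1 hB with rfl | rfl
  exacts [u_empty, u_j]

theorem exists_eq_zero_of_le_add_one {f : ℕ → ℤ} {m n : ℕ} (hmn : m ≤ n)
    (hf : ∀ k, m ≤ k → f k ≤ f (k + 1) + 1) (hm : 0 < f m) (hn : f n ≤ 0) :
    ∃ k, m < k ∧ k ≤ n ∧ f k = 0 := by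
  induction n, hmn using Nat.le_induction with
  | base => omega
  | succ n hmn ih =>
    rcases le_or_gt (f n) 0 with h | h
    · obtain ⟨k, hmk, hkn, hk⟩ := ih h
      exact ⟨k, hmk, by omega, hk⟩
    · have := hf n hmn
      exact ⟨n + 1, by omega, le_rfl, by omega⟩

/-- The number of points of `s` in `S` minus the number of points of `s` outside `S`. -/
def signedCount {α : Type*} [DecidableEq α] (S s : Finset α) : ℤ :=
  ∑ l ∈ s, if l ∈ S then 1 else -1

theorem signedCount_eq_zero_iff {α : Type*} [DecidableEq α] {S s : Finset α} :
    signedCount S s = 0 ↔ #(s \ S) = #(s ∩ S) := by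
  have : signedCount S s = #(s ∩ S) - #(s \ S) := by
    rw [signedCount, sum_ite, filter_mem_eq_inter, filter_notMem_eq_sdiff]
    simp [sub_eq_add_neg]
  omega

theorem even_card_of_signedCount_eq_zero {α : Type*} [DecidableEq α] {S s : Finset α}
    (h : signedCount S s = 0) : Even #s :=
  ⟨#(s ∩ S), by rw [← card_sdiff_add_card_inter s S, signedCount_eq_zero_iff.1 h]⟩

theorem signedCount_union {α : Type*} [DecidableEq α] (S : Finset α) {s t : Finset α}
    (hst : Disjoint s t) : signedCount S (s ∪ t) = signedCount S s + signedCount S t :=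
  sum_union hst

theorem exists_balanced_prefix {S : Finset ℕ} {i j : ℕ} (hij : i < j)
    (hbal : signedCount S (Icc i j) = 0) (hends : i ∈ S ↔ j ∈ S) :
    ∃ k, i < k ∧ k + 1 < j ∧ signedCount S (Icc i k) = 0 := by
  set χ : ℕ → ℤ := fun l => if l ∈ S then 1 else -1 with hχ
  have χ_mul (l l') : -1 ≤ χ l * χ l' := by simp only [hχ]; split_ifs <;> simp
  have χ_mul_self (l) : χ l * χ l = 1 := by simp only [hχ]; split_ifs <;> simp
  have χ_ends : χ j = χ i := by simp only [hχ, hends]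
  have signedCount_succ (k) (hk : i ≤ k) :
      signedCount S (Icc i (k + 1)) = signedCount S (Icc i k) + χ (k + 1) := by
    rw [signedCount, ← insert_Icc_right_eq_Icc_add_one (by omega), sum_insert (by simp), add_comm]
    rfl
  obtain ⟨j, rfl⟩ : ∃ j', j = j' + 1 := ⟨j - 1, by omega⟩
  have at_left : χ i * signedCount S (Icc i i) = 1 := by
    rw [Icc_self, signedCount, sum_singleton]
    exact χ_mul_self i
  have at_right : χ i * signedCount S (Icc i j) = -1 := by
    rw [signedCount_succ j (by omega), χ_ends] at hbal
    rw [eq_neg_of_add_eq_zero_left hbal, mul_neg, χ_mul_self]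
  obtain ⟨k, hik, hkj, hk⟩ := exists_eq_zero_of_le_add_one
    (f := fun k => χ i * signedCount S (Icc i k)) (m := i) (n := j) (by omega)
    (fun k hk => by rw [signedCount_succ k hk]; linarith [χ_mul i (k + 1)])
    (by omega) (by omega)
  have hkj' : k ≠ j := by
    rintro rfl
    omega
  refine ⟨k, hik, by omega, (mul_eq_zero.1 hk).resolve_left fun h => ?_⟩
  simpa [h] using χ_mul_self i

theorem Icc_union_Icc_add_one {i k j : ℕ} (hik : i ≤ k) (hkj : k ≤ j) :
    Icc i k ∪ Icc (k + 1) j = Icc i j := by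
  ext l
  simp only [mem_union, mem_Icc]
  omega

theorem disjoint_Icc_Icc_add_one (i k j : ℕ) : Disjoint (Icc i k) (Icc (k + 1) j) :=
  disjoint_left.2 fun l => by simp only [mem_Icc]; omega

theorem pair_union_Icc {i j : ℕ} (hij : i < j) : {i, j} ∪ Icc (i + 1) (j - 1) = Icc i j := by
  ext l
  simp only [mem_union, mem_insert, mem_singleton, mem_Icc]
  omega

theorem disjoint_pair_Icc (i j : ℕ) : Disjoint {i, j} (Icc (i + 1) (j - 1)) :=
  disjoint_left.2 fun l => by simp only [mem_insert, mem_singleton, mem_Icc]; omega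

theorem exists_nondegenerateOn_of_prefix {K : Type*} [CommRing K] [IsDomain K] [Infinite K]
    {S : Finset ℕ} {i k j : ℕ} (hik : i < k) (hkj : k + 1 < j)
    (hbal : signedCount S (Icc i j) = 0) (hprefix : signedCount S (Icc i k) = 0)
    {w₁ w₂ : ℕ → ℕ → ℕ → K}
    (hw₁ : NondegenerateOn S (Icc i k) fun A => razYehudayoffRec (zeroOne K A) w₁ i k)
    (hw₂ : NondegenerateOn S (Icc (k + 1) j)
      fun A => razYehudayoffRec (zeroOne K A) w₂ (k + 1) j) :
    ∃ w : ℕ → ℕ → ℕ → K, NondegenerateOn S (Icc i j)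
      fun A => razYehudayoffRec (zeroOne K A) w i j := by
  have heven : Even (k + 1 - i) := by
    simpa using even_card_of_signedCount_eq_zero hprefix
  obtain ⟨w₀, w, hw⟩ := exists_razYehudayoffRec_eq_split hik hkj heven w₁ w₂
  have hprod := hw₁.mul hw₂ (disjoint_Icc_Icc_add_one i k j)
    (fun A => razYehudayoffRec_zeroOne_inter A w₁ i k)
    (fun A => razYehudayoffRec_zeroOne_inter A w₂ (k + 1) j)
  rw [Icc_union_Icc_add_one hik.le (by omega)] at hprod
  obtain ⟨t, ht⟩ := hprod.exists_mul_add (signedCount_eq_zero_iff.1 hbal) fun A =>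
    (1 + zeroOne K A i * zeroOne K A j) * razYehudayoffRec (zeroOne K A) w₀ (i + 1) (j - 1)
  exact ⟨w t, by simpa only [hw] using ht⟩

theorem exists_nondegenerateOn_of_ends {K : Type*} [CommRing K] {S : Finset ℕ} {i j : ℕ}
    (hij : i < j) (hends : ¬(i ∈ S ↔ j ∈ S)) {w : ℕ → ℕ → ℕ → K}
    (hw : NondegenerateOn S (Icc (i + 1) (j - 1))
      fun A => razYehudayoffRec (zeroOne K A) w (i + 1) (j - 1)) :
    ∃ w' : ℕ → ℕ → ℕ → K, NondegenerateOn S (Icc i j)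
      fun A => razYehudayoffRec (zeroOne K A) w' i j := by
  obtain ⟨w', hw'⟩ := exists_razYehudayoffRec_eq_outer hij.le w
  have hpair : NondegenerateOn S {i, j} fun A => 1 + zeroOne K A i * zeroOne K A j := by
    by_cases hi : i ∈ S
    · exact nondegenerateOn_one_add_mul hi fun hj => hends (iff_of_true hi hj)
    · have hj : j ∈ S := by_contra fun hj => hends (iff_of_false hi hj)
      simpa only [pair_comm, mul_comm] using nondegenerateOn_one_add_mul (K := K) hj hi
  refine ⟨w', ?_⟩
  rw [← pair_union_Icc hij]
  simp only [hw']
  exact hpair.mul hw (disjoint_pair_Icc i j) (fun A => by simp [zeroOne])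
    (fun A => razYehudayoffRec_zeroOne_inter A w (i + 1) (j - 1))

theorem exists_nondegenerateOn_razYehudayoffRec {K : Type*} [CommRing K] [IsDomain K]
    [Infinite K] {S : Finset ℕ} {i j : ℕ} (hbal : signedCount S (Icc i j) = 0) :
    ∃ w : ℕ → ℕ → ℕ → K, NondegenerateOn S (Icc i j)
      fun A => razYehudayoffRec (zeroOne K A) w i j := by
  induction hn : j + 1 - i using Nat.strong_induction_on generalizing i j with
  | _ n ih =>
  subst hn
  rcases lt_trichotomy i j with hij | rfl | hij
  · by_cases hends : i ∈ S ↔ j ∈ S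
    · obtain ⟨k, hik, hkj, hprefix⟩ := exists_balanced_prefix hij hbal hends
      have hsuffix : signedCount S (Icc (k + 1) j) = 0 := by
        rwa [← Icc_union_Icc_add_one hik.le (by omega : k ≤ j),
          signedCount_union S (disjoint_Icc_Icc_add_one i k j), hprefix, zero_add] at hbal
      obtain ⟨w₁, hw₁⟩ := ih _ (by omega) hprefix rfl
      obtain ⟨w₂, hw₂⟩ := ih _ (by omega) hsuffix rfl
      exact exists_nondegenerateOn_of_prefix hik hkj hbal hprefix hw₁ hw₂
    · have hinner : signedCount S (Icc (i + 1) (j - 1)) = 0 := by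
        rw [← pair_union_Icc hij, signedCount_union S (disjoint_pair_Icc i j)] at hbal
        have hpair : signedCount S {i, j} = 0 := by
          rw [signedCount, sum_pair hij.ne]
          split_ifs <;> tauto
        rwa [hpair, zero_add] at hbal
      obtain ⟨w, hw⟩ := ih _ (by omega) hinner rfl
      exact exists_nondegenerateOn_of_ends hij hends hw
  · have := even_card_of_signedCount_eq_zero hbal
    simp at this
  · refine ⟨0, fun u hu B hB => ?_⟩
    simp only [Icc_eq_empty (not_le.2 hij), empty_sdiff, empty_inter, subset_empty,
      powerset_empty, sum_singleton, razYehudayoffRec_of_lt _ _ hij, one_mul] at hu hB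
    rw [hB, hu ∅ rfl]

/-- The shift `k ↦ k + 1` from the indices of `MvPolynomial (Fin N)` to those of
`x_1, …, x_N`. -/
def finSuccEmb (N : ℕ) : Fin N ↪ ℕ :=
  Fin.valEmbedding.trans (addRightEmbedding 1)

theorem signedCount_map_finSuccEmb {N : ℕ} {S : Finset (Fin N)} (hS : 2 * #S = N) :
    signedCount (S.map (finSuccEmb N)) (Icc 1 N) = 0 ∧ #(Icc 1 N \ S.map (finSuccEmb N)) = #S := by
  have hsub : S.map (finSuccEmb N) ⊆ Icc 1 N := by
    intro k hk
    obtain ⟨a, -, rfl⟩ := mem_map.1 hk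
    simp [finSuccEmb]
  have hcard : #(Icc 1 N \ S.map (finSuccEmb N)) = #S := by
    rw [card_sdiff_of_subset hsub, Nat.card_Icc, card_map]
    omega
  exact ⟨signedCount_eq_zero_iff.2 (by rw [hcard, inter_eq_right.2 hsub, card_map]), hcard⟩

/-- The weight `w_{i,k,j}` as an element of `F[W]`. -/
noncomputable def ryWeight (F : Type*) [Field F] (N i k j : ℕ) :
    MvPolynomial (Fin N × Fin N × Fin N) F :=
  if h : (1 ≤ i ∧ i ≤ N) ∧ (1 ≤ k ∧ k ≤ N) ∧ (1 ≤ j ∧ j ≤ N) then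
    MvPolynomial.X (⟨i - 1, by omega⟩, ⟨k - 1, by omega⟩, ⟨j - 1, by omega⟩)
  else 0

theorem eval_razYehudayoff (F : Type*) [Field F] (N : ℕ) (A : Finset ℕ) :
    MvPolynomial.eval (zeroOne (RYField F N)
        (A.preimage (finSuccEmb N) (finSuccEmb N).injective.injOn)) (razYehudayoff F N) =
      algebraMap (MvPolynomial (Fin N × Fin N × Fin N) F) (RYField F N)
        (razYehudayoffRec (zeroOne _ A) (ryWeight F N) 1 N) := by
  rw [razYehudayoff, map_razYehudayoffRec, map_razYehudayoffRec]
  refine razYehudayoffRec_congr (fun k h₁ h₂ => ?_) fun a b c h₁ h₂ h₃ h₄ => ?_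
  · rw [ryX, dif_pos ⟨h₁, h₂⟩, MvPolynomial.eval_X, map_zeroOne]
    simp [zeroOne, finSuccEmb, Nat.sub_add_cancel h₁]
  · rw [ryW, ryWeight, dif_pos (by omega), dif_pos (by omega), MvPolynomial.eval_C]

theorem two_pow_le_of_hasSplitRank_razYehudayoff (F : Type*) [Field F] {N : ℕ}
    {S : Finset (Fin N)} (hS : 2 * #S = N) {T : ℕ}
    (hT : HasSplitRank S T fun A =>
      MvPolynomial.eval (zeroOne (RYField F N) A) (razYehudayoff F N)) : 2 ^ #S ≤ T := by
  set S' := S.map (finSuccEmb N)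
  obtain ⟨hbal, hcard⟩ := signedCount_map_finSuccEmb hS
  have hbal' : #(Icc 1 N \ S') = #(Icc 1 N ∩ S') := signedCount_eq_zero_iff.1 hbal
  obtain ⟨w, hw⟩ := exists_nondegenerateOn_razYehudayoffRec (K := Polynomial F) hbal
  let substitute : MvPolynomial (Fin N × Fin N × Fin N) F →+* Polynomial F :=
    (MvPolynomial.aeval fun p => w (p.1 + 1) (p.2.1 + 1) (p.2.2 + 1)).toRingHom
  have substitute_rec (A : Finset ℕ) :
      substitute (razYehudayoffRec (zeroOne _ A) (ryWeight F N) 1 N) =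
        razYehudayoffRec (zeroOne _ A) w 1 N := by
    rw [map_razYehudayoffRec]
    refine razYehudayoffRec_congr (fun k _ _ => map_zeroOne _ _ _) fun a b c h₁ h₂ h₃ h₄ => ?_
    rw [ryWeight, dif_pos (by omega)]
    simp only [substitute, AlgHom.toRingHom_eq_coe, RingHom.coe_coe, MvPolynomial.aeval_X]
    rw [Nat.sub_add_cancel (by omega), Nat.sub_add_cancel (by omega),
      Nat.sub_add_cancel (by omega)]
  have hweight : NondegenerateOn S' (Icc 1 N) fun A =>
      razYehudayoffRec (zeroOne _ A) (ryWeight F N) 1 N :=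
    .of_map hbal' substitute (by simpa only [substitute_rec] using hw)
  have hfield := hweight.map hbal' (FaithfulSMul.algebraMap_injective
    (MvPolynomial (Fin N × Fin N × Fin N) F) (RYField F N))
  simp only [← eval_razYehudayoff] at hfield
  rw [← hcard]
  exact hfield.le_of_hasSplitRank (hT.map (finSuccEmb N))

end RazYehudayoff

section Mixing

open Finset

/-- How evenly `S` is mixed with its complement inside the fibres of `blk`: the sum over all fibres
of the number of points on the minority side. -/
def mixing {α J : Type*} [Fintype α] [DecidableEq α] [Fintype J] [DecidableEq J] (S : Finset α)
    (blk : α → J) : ℕ :=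
  ∑ j, min #{x ∈ S | blk x = j} #{x ∈ Sᶜ | blk x = j}

theorem sum_prod_filter_fiber {α J R : Type*} [Fintype α] [Fintype J] [DecidableEq J]
    [CommSemiring R] (blk : α → J) (f : J → Finset α → R) :
    ∑ S : Finset α, ∏ j, f j {x ∈ S | blk x = j} =
      ∏ j, ∑ C ∈ ({x | blk x = j} : Finset α).powerset, f j C := by
  classical
  rw [prod_univ_sum]
  refine sum_bij' (fun S _ j => {x ∈ S | blk x = j})
    (fun C _ => ({x | x ∈ C (blk x)} : Finset α)) ?_ (by simp) ?_ ?_ (fun _ _ => rfl)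
  · intro S _
    simpa [Fintype.mem_piFinset] using fun j => filter_subset_filter _ (subset_univ S)
  · intro S _
    ext x
    simp
  · intro C hC
    simp only [Fintype.mem_piFinset, mem_powerset] at hC
    ext j x
    simp only [mem_filter, mem_univ, true_and]
    constructor
    · rintro ⟨hx, rfl⟩
      exact hx
    · intro hx
      obtain rfl : blk x = j := by simpa using hC j hx
      exact ⟨hx, rfl⟩

theorem centralBinom_sq_mul_le (n : ℕ) : n.centralBinom ^ 2 * (2 * n + 1) ≤ 16 ^ n := by
  induction n with
  | zero => simp
  | succ n ih =>
    refine Nat.le_of_mul_le_mul_left (c := (n + 1) ^ 2) ?_ (by positivity)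
    calc (n + 1) ^ 2 * ((n + 1).centralBinom ^ 2 * (2 * (n + 1) + 1))
        = ((n + 1) * (n + 1).centralBinom) ^ 2 * (2 * (n + 1) + 1) := by ring
      _ = n.centralBinom ^ 2 * (2 * n + 1) * (4 * ((2 * n + 1) * (2 * n + 3))) := by
        rw [Nat.succ_mul_centralBinom_succ]
        ring
      _ ≤ 16 ^ n * (4 * (4 * (n + 1) ^ 2)) :=
        Nat.mul_le_mul ih (Nat.mul_le_mul_left _ (by nlinarith))
      _ = (n + 1) ^ 2 * 16 ^ (n + 1) := by ring

theorem centralBinom_mul_le_four_pow (h : ℕ) :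
    (128 * h ^ 2).centralBinom * (16 * h) ≤ 4 ^ (128 * h ^ 2) := by
  refine (Nat.pow_le_pow_iff_left two_ne_zero).1 ?_
  calc ((128 * h ^ 2).centralBinom * (16 * h)) ^ 2
      = (128 * h ^ 2).centralBinom ^ 2 * (2 * (128 * h ^ 2)) := by ring
    _ ≤ (128 * h ^ 2).centralBinom ^ 2 * (2 * (128 * h ^ 2) + 1) :=
      Nat.mul_le_mul_left _ (Nat.le_succ _)
    _ ≤ 16 ^ (128 * h ^ 2) := centralBinom_sq_mul_le _
    _ = (4 ^ (128 * h ^ 2)) ^ 2 := by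
      rw [show (16 : ℕ) = 4 ^ 2 by rfl, pow_right_comm]

theorem sum_range_pow_dist_le {ρ : ℝ} (h₀ : 0 ≤ ρ) (h₁ : ρ < 1) (a : ℕ) :
    ∑ k ∈ range (2 * a + 1), ρ ^ Nat.dist k a ≤ 2 * (1 - ρ)⁻¹ := by
  have geom_le (n) : ∑ i ∈ range n, ρ ^ i ≤ (1 - ρ)⁻¹ := by
    rw [← tsum_geometric_of_lt_one h₀ h₁]
    exact (summable_geometric_of_lt_one h₀ h₁).sum_le_tsum _ fun i _ => pow_nonneg h₀ i
  have left_le : ∑ k ∈ range a, ρ ^ Nat.dist k a ≤ ∑ k ∈ range a, ρ ^ k := by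
    rw [← sum_range_reflect]
    refine sum_le_sum fun k hk => pow_le_pow_of_le_one h₀ h₁.le ?_
    rw [mem_range] at hk
    rw [Nat.dist]
    omega
  have right_eq : ∑ k ∈ range (a + 1), ρ ^ Nat.dist (a + k) a = ∑ k ∈ range (a + 1), ρ ^ k := by
    refine sum_congr rfl fun k _ => ?_
    rw [Nat.dist]
    congr 1
    omega
  rw [show 2 * a + 1 = a + (a + 1) by ring, sum_range_add, right_eq, two_mul]
  exact add_le_add (left_le.trans (geom_le _)) (geom_le _)

theorem sum_powerset_pow_dist_le {α : Type*} {B : Finset α} {a : ℕ} (hB : #B = 2 * a) {ρ : ℝ}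
    (h₀ : 0 ≤ ρ) (h₁ : ρ < 1) :
    ∑ C ∈ B.powerset, ρ ^ Nat.dist #C a ≤ a.centralBinom * (2 * (1 - ρ)⁻¹) := by
  rw [sum_powerset_apply_card (fun k => ρ ^ Nat.dist k a), hB]
  calc ∑ k ∈ range (2 * a + 1), (2 * a).choose k • ρ ^ Nat.dist k a
      ≤ ∑ k ∈ range (2 * a + 1), (a.centralBinom : ℝ) * ρ ^ Nat.dist k a := by
        refine sum_le_sum fun k _ => ?_
        rw [nsmul_eq_mul]
        gcongr
        exact Nat.choose_le_centralBinom k a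
    _ ≤ a.centralBinom * (2 * (1 - ρ)⁻¹) := by
        rw [← mul_sum]
        gcongr
        exact sum_range_pow_dist_le h₀ h₁ a

section Deviation

variable {h : ℕ}

/-- The base `1 - 1 / (2 * h)` of the exponential moment: a deviation of `h` costs only a factor
`1 / 2`, whereas the moment over a block of size `256 * h ^ 2` is at most `1 / 4`. -/
noncomputable def momentBase (h : ℕ) : ℝ :=
  1 - 1 / (2 * h)

theorem momentBase_lt_one (hh : 0 < h) : momentBase h < 1 :=
  sub_lt_self 1 (by positivity)

theorem one_half_le_momentBase (hh : 0 < h) : 1 / 2 ≤ momentBase h := by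
  have hh' : (1 : ℝ) ≤ h := by exact_mod_cast hh
  have : 1 / (2 * h : ℝ) ≤ 1 / 2 := by gcongr; linarith
  rw [momentBase]
  linarith

theorem momentBase_nonneg (hh : 0 < h) : 0 ≤ momentBase h :=
  le_trans (by norm_num) (one_half_le_momentBase hh)

theorem one_half_le_momentBase_pow (hh : 0 < h) : 1 / 2 ≤ momentBase h ^ h := by
  have bernoulli := one_add_mul_le_pow (a := momentBase h - 1)
    (by linarith [momentBase_nonneg hh]) h
  rw [add_sub_cancel] at bernoulli
  refine le_trans (le_of_eq ?_) bernoulli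
  rw [momentBase]
  field_simp
  norm_num

theorem sum_powerset_momentBase_pow_dist_le {α : Type*} {B : Finset α} (hh : 0 < h)
    (hB : #B = 2 * (128 * h ^ 2)) :
    ∑ C ∈ B.powerset, momentBase h ^ Nat.dist #C (128 * h ^ 2) ≤ 2 ^ #B / 4 := by
  have hinv : (1 - momentBase h)⁻¹ = 2 * h := by simp [momentBase]
  have hbinom : ((128 * h ^ 2).centralBinom : ℝ) * (16 * h) ≤ 4 ^ (128 * h ^ 2) := by
    exact_mod_cast centralBinom_mul_le_four_pow h
  calc ∑ C ∈ B.powerset, momentBase h ^ Nat.dist #C (128 * h ^ 2)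
      ≤ (128 * h ^ 2).centralBinom * (2 * (2 * h)) :=
        hinv ▸ sum_powerset_pow_dist_le hB (momentBase_nonneg hh) (momentBase_lt_one hh)
    _ = (128 * h ^ 2).centralBinom * (16 * h) / 4 := by ring
    _ ≤ 4 ^ (128 * h ^ 2) / 4 := by gcongr
    _ = 2 ^ #B / 4 := by rw [hB, pow_mul 2 2, show (2 : ℝ) ^ 2 = 4 by norm_num]

variable {α : Type*} [Fintype α] {q : ℕ}

theorem sum_momentBase_pow_sum_dist_le (hh : 0 < h) {blk : α → Fin (q + 1)}
    (hcard : ∀ j : Fin q, #{x | blk x = j.castSucc} = 2 * (128 * h ^ 2)) :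
    ∑ S : Finset α, momentBase h ^
        ∑ j : Fin q, Nat.dist #{x ∈ S | blk x = j.castSucc} (128 * h ^ 2) ≤
      2 ^ Fintype.card α * (1 / 4) ^ q := by
  have factor := sum_prod_filter_fiber blk (Fin.snoc
    (fun (_ : Fin q) (C : Finset α) => momentBase h ^ Nat.dist #C (128 * h ^ 2))
    fun _ => (1 : ℝ))
  simp only [Fin.prod_univ_castSucc, Fin.snoc_castSucc, Fin.snoc_last, mul_one,
    prod_pow_eq_pow_sum, sum_const, card_powerset, nsmul_one] at factor
  have sum_card : ∑ j : Fin q, #{x | blk x = j.castSucc} + #{x | blk x = Fin.last q} =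
      Fintype.card α := by
    rw [← Fin.sum_univ_castSucc (fun j => #{x | blk x = j})]
    exact (card_eq_sum_card_fiberwise fun x _ => mem_univ (blk x)).symm
  rw [factor, ← sum_card, pow_add, ← prod_pow_eq_pow_sum, mul_right_comm]
  push_cast
  gcongr
  calc ∏ j : Fin q, ∑ C ∈ ({x | blk x = j.castSucc} : Finset α).powerset,
        momentBase h ^ Nat.dist #C (128 * h ^ 2)
      ≤ ∏ j : Fin q, (2 ^ #{x | blk x = j.castSucc} / 4 : ℝ) := by
        gcongr with j
        · exact fun _ _ => sum_nonneg fun _ _ => pow_nonneg (momentBase_nonneg hh) _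
        · exact sum_powerset_momentBase_pow_dist_le hh (hcard j)
    _ = (∏ j : Fin q, 2 ^ #{x | blk x = j.castSucc}) * (1 / 4) ^ q := by
        simp [div_eq_mul_inv, prod_mul_distrib]

/-- Markov's inequality for the exponential moment. -/
theorem two_pow_mul_card_filter_sum_dist_lt_le (hh : 0 < h) {blk : α → Fin (q + 1)}
    (hcard : ∀ j : Fin q, #{x | blk x = j.castSucc} = 2 * (128 * h ^ 2)) :
    2 ^ q * #{S : Finset α | ∑ j : Fin q,
        Nat.dist #{x ∈ S | blk x = j.castSucc} (128 * h ^ 2) < q * h} ≤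
      2 ^ Fintype.card α := by
  set dev : Finset α → ℕ := fun S =>
    ∑ j : Fin q, Nat.dist #{x ∈ S | blk x = j.castSucc} (128 * h ^ 2)
  have le_moment (S) (hS : dev S < q * h) : (1 / 2 : ℝ) ^ q ≤ momentBase h ^ dev S := by
    calc (1 / 2 : ℝ) ^ q ≤ (momentBase h ^ h) ^ q := by
          gcongr
          exact one_half_le_momentBase_pow hh
      _ = momentBase h ^ (q * h) := by rw [← pow_mul, mul_comm]
      _ ≤ momentBase h ^ dev S :=
        pow_le_pow_of_le_one (momentBase_nonneg hh) (momentBase_lt_one hh).le hS.le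
  have markov : #{S | dev S < q * h} * (1 / 2 : ℝ) ^ q ≤
      2 ^ Fintype.card α * (1 / 4) ^ q := by
    refine le_trans ?_ (sum_momentBase_pow_sum_dist_le hh hcard)
    rw [← nsmul_eq_mul]
    refine (card_nsmul_le_sum _ _ _ fun S hS => le_moment S (mem_filter.1 hS).2).trans ?_
    exact sum_le_sum_of_subset_of_nonneg (filter_subset _ _)
      fun S _ _ => pow_nonneg (momentBase_nonneg hh) _
  have hquarter : (1 / 4 : ℝ) ^ q * 2 ^ q = (1 / 2) ^ q := by rw [← mul_pow]; norm_num
  have : (2 : ℝ) ^ q * #{S | dev S < q * h} ≤ 2 ^ Fintype.card α := by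
    refine le_of_mul_le_mul_right ?_ (show (0 : ℝ) < (1 / 2) ^ q by positivity)
    calc _ = #{S | dev S < q * h} * (1 / 2 : ℝ) ^ q * 2 ^ q := by ring
      _ ≤ 2 ^ Fintype.card α * (1 / 4) ^ q * 2 ^ q := by gcongr
      _ = 2 ^ Fintype.card α * (1 / 2) ^ q := by rw [mul_assoc, hquarter]
  exact_mod_cast this

theorem mixing_add_sum_dist_le [DecidableEq α] {n a : ℕ} (hα : Fintype.card α = 2 * n)
    {blk : α → Fin (q + 1)}
    (hcard : ∀ j : Fin q, #{x | blk x = j.castSucc} = 2 * a) (S : Finset α) :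
    mixing S blk + ∑ j : Fin q, Nat.dist #{x ∈ S | blk x = j.castSucc} a ≤ n := by
  have hsplit (j) : #{x ∈ S | blk x = j} + #{x ∈ Sᶜ | blk x = j} = #{x | blk x = j} := by
    rw [← card_union_of_disjoint (disjoint_filter_filter disjoint_compl_right), ← filter_union,
      union_compl]
  have hblock (j : Fin q) :
      2 * (min #{x ∈ S | blk x = j.castSucc} #{x ∈ Sᶜ | blk x = j.castSucc} +
        Nat.dist #{x ∈ S | blk x = j.castSucc} a) =
      #{x | blk x = j.castSucc} := by
    have := hsplit j.castSucc
    rw [hcard j] at this ⊢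
    rw [Nat.dist]
    omega
  have hsum := sum_congr rfl fun j (_ : j ∈ univ) => hblock j
  rw [← mul_sum, sum_add_distrib] at hsum
  have hfibers : ∑ j, #{x | blk x = j} = 2 * n :=
    hα ▸ (card_eq_sum_card_fiberwise fun x _ => mem_univ (blk x)).symm
  rw [Fin.sum_univ_castSucc] at hfibers
  rw [mixing, Fin.sum_univ_castSucc]
  have := hsplit (Fin.last q)
  omega

theorem exists_mixing_add_le [DecidableEq α] {ι : Type*} [Fintype ι] {n : ℕ} (hn : 0 < n)
    (hα : Fintype.card α = 2 * n) (hh : 0 < h) {blk : ι → α → Fin (q + 1)}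
    (hcard : ∀ t, ∀ j : Fin q, #{x | blk t x = j.castSucc} = 2 * (128 * h ^ 2))
    (hι : Fintype.card ι * (2 * n) < 2 ^ q) :
    ∃ S : Finset α, #S = n ∧ ∀ t, mixing S (blk t) + q * h ≤ n := by
  set dev : ι → Finset α → ℕ := fun t S =>
    ∑ j : Fin q, Nat.dist #{x ∈ S | blk t x = j.castSucc} (128 * h ^ 2)
  suffices hdev : ∃ S : Finset α, #S = n ∧ ∀ t, q * h ≤ dev t S by
    obtain ⟨S, hS, hdev⟩ := hdev
    exact ⟨S, hS, fun t => (Nat.add_le_add_left (hdev t) _).trans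
      (mixing_add_sum_dist_le hα (hcard t) S)⟩
  by_contra! hcon
  have hcover : powersetCard n (univ : Finset α) ⊆ univ.biUnion fun t => {S | dev t S < q * h} :=
    fun S hS => by simpa using hcon S (mem_powersetCard.1 hS).2
  have union_bound : n.centralBinom ≤ ∑ t, #{S | dev t S < q * h} := by
    simpa [hα, Nat.centralBinom_eq_two_mul_choose] using
      (card_le_card hcover).trans card_biUnion_le
  refine hι.not_ge (Nat.le_of_mul_le_mul_right ?_ n.centralBinom_pos)
  calc 2 ^ q * n.centralBinom ≤ ∑ t, 2 ^ q * #{S | dev t S < q * h} := by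
        rw [← mul_sum]
        exact Nat.mul_le_mul_left _ union_bound
    _ ≤ ∑ _t : ι, 4 ^ n := by
        refine sum_le_sum fun t _ => ?_
        simpa [hα, pow_mul] using two_pow_mul_card_filter_sum_dist_lt_le hh (hcard t)
    _ = Fintype.card ι * 4 ^ n := by simp
    _ ≤ Fintype.card ι * (2 * n * n.centralBinom) :=
      Nat.mul_le_mul_left _ (Nat.four_pow_le_two_mul_self_mul_centralBinom n hn)
    _ = Fintype.card ι * (2 * n) * n.centralBinom := (mul_assoc _ _ _).symm

end Deviation

end Mixing

section ReadOnce

open Finset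

theorem filter_append_filter_not_of_pairwise {ι : Type*} {p : ι → Prop} [DecidablePred p]
    {l : List ι} (hl : l.Pairwise fun a b => p b → p a) :
    l.filter (p ·) ++ l.filter (¬p ·) = l := by
  induction l with
  | nil => rfl
  | cons a l ih =>
    obtain ⟨ha, hl⟩ := List.pairwise_cons.1 hl
    by_cases hpa : p a
    · simpa [hpa] using ih hl
    · have hnot (b) (hb : b ∈ l) : ¬p b := fun hpb => hpa (ha b hb hpb)
      have hnil : l.filter (p ·) = [] := List.filter_eq_nil_iff.2 (by simpa using hnot)
      have hself : l.filter (¬p ·) = l := List.filter_eq_self.2 (by simpa using hnot)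
      simpa [hpa, hnil] using hself

theorem HasSplitRank.list_prod_apply {α ι J V K : Type*} [DecidableEq α] [LinearOrder J]
    [Fintype V] [DecidableEq V] [CommSemiring K] {S : Finset α} {c : ι → J} {B : J → Finset α}
    {T : Finset α → ι → Matrix V V K} (hT : ∀ A i, T A i = T (A ∩ B (c i)) i) {l : List ι}
    (hl : l.Pairwise fun i i' => c i ≤ c i') {s : Finset J} (hs : ∀ i ∈ l, c i ∈ s) (u v : V) :
    HasSplitRank S (Fintype.card V ^ #s * 2 ^ ∑ j ∈ s, min #(B j ∩ S) #(B j \ S))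
      fun A => (l.map (T A)).prod u v := by
  induction s using Finset.induction_on_max generalizing l v with
  | empty =>
    obtain rfl : l = [] := List.eq_nil_iff_forall_not_mem.2 fun i hi => by simpa using hs i hi
    simpa using HasSplitRank.const _
  | insert a s ha ih =>
    have ha' : a ∉ s := fun h => lt_irrefl a (ha a h)
    have hsplit : l.filter (c · < a) ++ l.filter (¬c · < a) = l :=
      filter_append_filter_not_of_pairwise (hl.imp fun h h' => h.trans_lt h')
    have hfactor (A) : (l.map (T A)).prod u v =
        ∑ k, ((l.filter (c · < a)).map (T A)).prod u k *
          ((l.filter (¬c · < a)).map (T A)).prod k v := by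
      rw [← Matrix.mul_apply, ← List.prod_append, ← List.map_append, hsplit]
    have hinit (k) := ih (l := l.filter (c · < a)) (hl.filter _) (fun i hi => by
      rw [List.mem_filter, decide_eq_true_iff] at hi
      exact (mem_insert.1 (hs i hi.1)).resolve_left hi.2.ne) k
    have hlast (k) : HasSplitRank S (2 ^ min #(B a ∩ S) #(B a \ S))
        fun A => ((l.filter (¬c · < a)).map (T A)).prod k v := by
      refine .of_dependsOn fun A => ?_
      refine congr_arg (fun M : List (Matrix V V K) => M.prod k v)
        (List.map_congr_left fun i hi => ?_)
      rw [List.mem_filter, decide_eq_true_iff] at hi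
      have hca : c i = a := (mem_insert.1 (hs i hi.1)).resolve_right fun h => hi.2 (ha _ h)
      rw [hT A i, hca]
    simp only [hfactor]
    refine (HasSplitRank.sum_const fun k => (hinit k).mul (hlast k)).mono (le_of_eq ?_)
    rw [card_insert_of_notMem ha', sum_insert ha']
    ring

theorem hasSplitRank_readOnce {α J V K : Type*} [Fintype α] [DecidableEq α] [LinearOrder J]
    [OrderBot J] [Fintype J] [Fintype V] [DecidableEq V] [CommSemiring K] {len : ℕ}
    {T : Finset α → Fin len → Matrix V V K} {lay : α → ℕ}
    (hinj : ∀ x y, lay x = lay y → lay x < len → x = y)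
    (hT : ∀ (i : Fin len) A A', (∀ x, lay x = i → (x ∈ A ↔ x ∈ A')) → T A i = T A' i) {blk : α → J}
    (hblk : ∀ x y, lay x < lay y → blk x ≤ blk y) (S : Finset α) (u v : V) :
    HasSplitRank S (Fintype.card V ^ Fintype.card J * 2 ^ mixing S blk)
      fun A => (List.ofFn (T A)).prod u v := by
  -- Layer `i` goes to the last block that contains a variable read in a layer up to `i`.
  set c : Fin len → J := fun i => ({x | lay x ≤ i} : Finset α).sup blk
  have c_eq (i : Fin len) (x) (hx : lay x = i) : c i = blk x := by
    refine le_antisymm (Finset.sup_le fun y hy => ?_) (le_sup (by simp [hx]))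
    rw [mem_filter, ← hx] at hy
    rcases hy.2.lt_or_eq with hlt | heq
    · exact hblk y x hlt
    · rw [hinj x y heq.symm (hx ▸ i.isLt)]
  have c_mono : Monotone c := fun i i' hii => sup_mono fun x hx => by
    rw [mem_filter] at hx ⊢
    exact ⟨hx.1, hx.2.trans hii⟩
  have hdep (A i) : T A i = T (A ∩ ({x | blk x = c i} : Finset α)) i :=
    hT i _ _ fun x hx => by simp [c_eq i x hx]
  have hrank := HasSplitRank.list_prod_apply (S := S) (B := fun j => {x | blk x = j}) hdep
    (l := List.finRange len) ((List.pairwise_le_finRange len).imp fun h => c_mono h)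
    (s := univ) (fun i _ => mem_univ _) u v
  have hmix : ∑ j, min #(({x | blk x = j} : Finset α) ∩ S) #(({x | blk x = j} : Finset α) \ S) =
      mixing S blk := by
    refine sum_congr rfl fun j _ => ?_
    congr 2 <;> ext x <;> simp [and_comm]
  simpa only [hmix, card_univ, List.ofFn_eq_map] using hrank

theorem exists_blocks {N b q : ℕ} {L : Type*} [LinearOrder L] (lay : Fin N → L) (hb : 0 < b)
    (hN : q * b ≤ N) :
    ∃ blk : Fin N → Fin (q + 1), (∀ x y, lay x < lay y → blk x ≤ blk y) ∧
      ∀ j : Fin q, #{x | blk x = j.castSucc} = b := by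
  set e := Tuple.sort lay
  have he : Monotone (lay ∘ e) := Tuple.monotone_sort lay
  refine ⟨fun x => ⟨min q (e.symm x / b), by omega⟩, fun x y hxy => ?_, fun j => ?_⟩
  · have hlt : e.symm x < e.symm y := he.reflect_lt (by simpa using hxy)
    exact min_le_min_left _ (Nat.div_le_div_right hlt.le)
  · have hj : (j + 1) * b ≤ N := (Nat.mul_le_mul_right b j.isLt).trans hN
    have hmem (k) : min q (k / b) = j ↔ k ∈ Ico (j * b) ((j + 1) * b) := by
      rw [mem_Ico, ← Nat.le_div_iff_mul_le hb, ← Nat.div_lt_iff_lt_mul hb]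
      omega
    calc #{x | (⟨min q (e.symm x / b), by omega⟩ : Fin (q + 1)) = j.castSucc}
        = #{y : Fin N | (y : ℕ) ∈ Ico (j * b) ((j + 1) * b)} :=
          card_equiv e.symm fun x => by simp [Fin.ext_iff, ← hmem]
      _ = #(Ico (j * b) ((j + 1) * b)) := by
          rw [← card_map Fin.valEmbedding]
          congr 1
          ext k
          simp only [mem_map, mem_filter, mem_univ, true_and, Fin.valEmbedding_apply]
          exact ⟨by rintro ⟨y, hy, rfl⟩; exact hy,
            fun hk => ⟨⟨k, (mem_Ico.1 hk).2.trans_le hj⟩, hk, rfl⟩⟩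
      _ = b := by
          rw [Nat.card_Ico, add_mul, one_mul, Nat.add_sub_cancel_left]

theorem list_prod_ofFn_apply_eq_sum {V K : Type*} [Fintype V] [DecidableEq V] [CommSemiring K]
    {n : ℕ} (T : Fin n → Matrix V V K) (s t : V) :
    (List.ofFn T).prod s t = ∑ u : Fin (n + 1) → V with u 0 = s ∧ u (Fin.last n) = t,
      ∏ i : Fin n, T i (u i.castSucc) (u i.succ) := by
  rw [sum_filter]
  induction n generalizing s with
  | zero =>
    rw [← (Equiv.funUnique (Fin 1) V).symm.sum_comp]
    simp [Matrix.one_apply, ite_and]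
  | succ n ih =>
    rw [List.ofFn_succ, List.prod_cons, Matrix.mul_apply, ← (Fin.consEquiv fun _ => V).sum_comp,
      Fintype.sum_prod_type]
    simp only [ih, mul_sum]
    rw [sum_comm, sum_comm (s := univ) (t := univ) (f := fun v u => ite _ _ _)]
    refine sum_congr rfl fun u _ => ?_
    rw [sum_eq_single (u 0) (fun k _ hk => by simp [hk.symm]) (by simp),
      sum_eq_single s (fun v _ hv => by simp [hv]) (by simp)]
    simp [Fin.prod_univ_succ, ← Fin.succ_last, ← Fin.succ_castSucc, -Fin.castSucc_succ]

end ReadOnce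

section Passes

open Finset

theorem exists_cuts_of_sublist_flatten {σ : Type*} (Ls : List (List σ)) (hLs : ∀ L ∈ Ls, L.Nodup)
    (l : List (Option σ)) (hl : l.reduceOption.Sublist Ls.flatten) :
    ∃ cut : Fin Ls.length → ℕ, ∀ (i i' : ℕ) (x : σ), i < i' → l[i]? = some (some x) →
      l[i']? = some (some x) → ∃ a, i < cut a ∧ cut a ≤ i' := by
  induction Ls generalizing l with
  | nil =>
    refine ⟨fun _ => 0, fun i i' x _ hi _ => ?_⟩
    have hmem : x ∈ l.reduceOption := List.reduceOption_mem_iff.2 (List.mem_of_getElem? hi)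
    rw [List.flatten_nil, List.sublist_nil] at hl
    simp [hl] at hmem
  | cons L Ls ih =>
    rw [List.flatten_cons, List.sublist_append_iff] at hl
    obtain ⟨_, _, hl, hfirst, hrest⟩ := hl
    obtain ⟨m₁, m₂, rfl, rfl, rfl⟩ := List.filterMap_eq_append_iff.1 hl
    obtain ⟨cut, hcut⟩ := ih (fun L hL => hLs L (by simp [hL])) m₂ hrest
    refine ⟨Fin.cons m₁.length fun a => m₁.length + cut a, fun i i' x hii hi hi' => ?_⟩
    by_cases hi'_lt : i' < m₁.length
    · rw [List.getElem?_append_left (by omega)] at hi hi'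
      have nodup : (List.filterMap id m₁).Nodup := (hLs L (by simp)).sublist hfirst
      rw [List.Nodup, List.pairwise_filterMap] at nodup
      exact absurd rfl (List.pairwise_iff_getElem.1 nodup i i' (by omega) hi'_lt hii x
        (List.getElem?_eq_some_iff.1 hi).2 x (List.getElem?_eq_some_iff.1 hi').2)
    by_cases hi_lt : i < m₁.length
    · exact ⟨0, hi_lt, not_lt.1 hi'_lt⟩
    · rw [List.getElem?_append_right (by omega)] at hi hi'
      obtain ⟨a, ha, ha'⟩ := hcut _ _ x (by omega) hi hi'
      exact ⟨a.succ, by rw [Fin.cons_succ]; omega, by rw [Fin.cons_succ]; omega⟩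

/-- Between any two layers in which `v` reads the same variable there is one of the layers
`cut a`. -/
def SeparatesReads {σ : Type*} {len r : ℕ} (v : Fin len → Option σ)
    (cut : Fin r → Fin (len + 1)) : Prop :=
  ∀ i i' x, i < i' → v i = some x → v i' = some x → ∃ a, i.castSucc < cut a ∧ cut a ≤ i'.castSucc

theorem exists_separatesReads {σ : Type*} {len r : ℕ} {v : Fin len → Option σ}
    {passes : Fin r → List σ} (hpasses : ∀ a, (passes a).Nodup)
    (hv : (List.ofFn v).reduceOption.Sublist (List.ofFn passes).flatten) :
    ∃ cut : Fin r → Fin (len + 1), SeparatesReads v cut := by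
  obtain ⟨cut, hcut⟩ := exists_cuts_of_sublist_flatten _
    (List.forall_mem_ofFn_iff.2 hpasses) _ hv
  refine ⟨fun a => ⟨min (cut (a.cast List.length_ofFn.symm)) len, by omega⟩,
    fun i i' x hii hi hi' => ?_⟩
  obtain ⟨a, ha, ha'⟩ := hcut i i' x hii (by simp [hi]) (by simp [hi'])
  exact ⟨a.cast List.length_ofFn, Fin.lt_def.2 (lt_min ha i.isLt),
    Fin.le_def.2 ((min_le_left _ _).trans ha')⟩

namespace ABP

variable {σ K : Type*} {P : ABP σ K}

section Paths

variable {u u' : Fin (P.len + 1) → Fin P.size} {e e' : Fin P.len → Fin P.numEdges}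

theorem IsPath.layer_eq (h : P.IsPath u e) (i : Fin (P.len + 1)) : P.layer (u i) = i := by
  induction i using Fin.induction with
  | zero => rw [h.1, P.layer_start]
  | succ i ih =>
    ext
    rw [← (h.2.2 i).2, P.layer_tgt, (h.2.2 i).1, ih, Fin.val_castSucc, Fin.val_succ]

theorem IsPath.layer_src (h : P.IsPath u e) (i : Fin P.len) :
    P.layer (P.src (e i)) = i.castSucc := by
  rw [(h.2.2 i).1, h.layer_eq]

theorem IsPath.splice (h : P.IsPath u e) (h' : P.IsPath u' e') {c : Fin (P.len + 1)}
    (hc : u c = u' c) :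
    P.IsPath (fun i => if i < c then u i else u' i)
      (fun i => if i.castSucc < c then e i else e' i) := by
  refine ⟨?_, ?_, fun i => ?_⟩
  · beta_reduce
    rw [h.1, h'.1, ite_self]
  · simpa [(Fin.le_last c).not_gt] using h'.2.1
  · beta_reduce
    by_cases hi : i.castSucc < c
    · rw [if_pos hi, if_pos hi]
      rcases (Fin.castSucc_lt_iff_succ_le.1 hi).lt_or_eq with hlt | rfl
      · rw [if_pos hlt]
        exact h.2.2 i
      · rw [if_neg (lt_irrefl _), ← hc]
        exact h.2.2 i
    · rw [if_neg hi, if_neg hi, if_neg fun hlt => hi (i.castSucc_lt_succ.trans hlt)]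
      exact h'.2.2 i

theorem IsSyntacticMultilinear.ne_of_lt_of_le (hP : P.IsSyntacticMultilinear)
    (h : P.IsPath u e) (h' : P.IsPath u' e') {c : Fin (P.len + 1)} (hc : u c = u' c)
    {i i' : Fin P.len} (hi : i.castSucc < c) (hi' : c ≤ i'.castSucc) {x y : σ}
    (hx : P.label (e i) = Sum.inl x) (hy : P.label (e' i') = Sum.inl y) : x ≠ y := by
  rintro rfl
  refine (hi.trans_le hi').ne (congr_arg _ (hP _ _ (h.splice h' hc) x i i' ?_ ?_))
  · simpa [hi] using hx
  · simpa [hi'.not_gt] using hy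

end Paths

variable (P) in
open Classical in
/-- The set of all paths from the start node to the terminal node. -/
noncomputable def paths : Finset ((Fin (P.len + 1) → Fin P.size) × (Fin P.len → Fin P.numEdges)) :=
  {p | P.IsPath p.1 p.2}

theorem mem_paths {p : (Fin (P.len + 1) → Fin P.size) × (Fin P.len → Fin P.numEdges)} :
    p ∈ P.paths ↔ P.IsPath p.1 p.2 := by
  simp [paths]

variable (P) in
/-- The transition matrix between layer `i` and layer `i + 1` for given weights of the edges. -/
def layerMatrix [CommSemiring K] (w : Fin P.numEdges → K) (i : Fin P.len) :
    Matrix (Fin P.size) (Fin P.size) K :=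
  Matrix.of fun a b =>
    ∑ e with P.layer (P.src e) = i.castSucc ∧ P.src e = a ∧ P.tgt e = b, w e

theorem sum_paths_prod_eq [CommSemiring K] (w : Fin P.numEdges → K) :
    ∑ p ∈ P.paths, ∏ i, w (p.2 i) = (List.ofFn (P.layerMatrix w)).prod P.start P.term := by
  classical
  rw [list_prod_ofFn_apply_eq_sum, paths, sum_filter, Fintype.sum_prod_type, sum_filter]
  refine sum_congr rfl fun u _ => ?_
  by_cases hu : u 0 = P.start ∧ u (Fin.last P.len) = P.term
  · rw [if_pos hu]
    simp only [layerMatrix, Matrix.of_apply]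
    rw [prod_univ_sum, ← sum_filter]
    refine sum_congr ?_ fun _ _ => rfl
    ext e
    simp only [mem_filter, mem_univ, true_and, Fintype.mem_piFinset]
    exact ⟨fun h i => ⟨h.layer_src i, h.2.2 i⟩, fun h => ⟨hu.1, hu.2, fun i => (h i).2⟩⟩
  · rw [if_neg hu]
    exact sum_eq_zero fun e _ => if_neg fun h => hu ⟨h.1, h.2.1⟩

section Cuts

variable {r : ℕ} {cut : Fin r → Fin (P.len + 1)} {τ : Fin r → Fin P.size}

variable (P) in
/-- The edge `e` lies on some path that passes through the nodes `τ` of the layers `cut`. -/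
def IsLive (cut : Fin r → Fin (P.len + 1)) (τ : Fin r → Fin P.size) (e : Fin P.numEdges) : Prop :=
  ∃ p ∈ P.paths, p.1 ∘ cut = τ ∧ e ∈ Set.range p.2

theorem IsLive.exists_reads {v : Fin P.len → Option σ} (hv : P.Reads v) {e : Fin P.numEdges}
    (he : P.IsLive cut τ e) {x : σ} (hx : P.label e = Sum.inl x) :
    ∃ i : Fin P.len, P.layer (P.src e) = i.castSucc ∧ v i = some x := by
  obtain ⟨p, hp, -, i, rfl⟩ := he
  have hi := (mem_paths.1 hp).layer_src i
  exact ⟨i, hi, hv i _ x hi hx⟩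

theorem IsLive.layer_src_le (hP : P.IsSyntacticMultilinear) {v : Fin P.len → Option σ}
    (hv : P.Reads v) (hcut : SeparatesReads v cut) {e e' : Fin P.numEdges}
    (he : P.IsLive cut τ e) (he' : P.IsLive cut τ e') {x : σ} (hx : P.label e = Sum.inl x)
    (hx' : P.label e' = Sum.inl x) : P.layer (P.src e') ≤ P.layer (P.src e) := by
  by_contra! hlt
  obtain ⟨p, hp, hτ, i, rfl⟩ := he
  obtain ⟨p', hp', hτ', i', rfl⟩ := he'
  rw [mem_paths] at hp hp'
  rw [hp.layer_src, hp'.layer_src] at hlt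
  obtain ⟨a, hi, hi'⟩ := hcut i i' x hlt (hv i _ x (hp.layer_src i) hx)
    (hv i' _ x (hp'.layer_src i') hx')
  exact hP.ne_of_lt_of_le hp hp' (congr_fun (hτ.trans hτ'.symm) a) hi hi' hx hx' rfl

theorem exists_layer_of_separatesReads (hP : P.IsSyntacticMultilinear)
    {v : Fin P.len → Option σ} (hv : P.Reads v) (hcut : SeparatesReads v cut)
    (τ : Fin r → Fin P.size) :
    ∃ lay : σ → ℕ,
      (∀ e x, P.IsLive cut τ e → P.label e = Sum.inl x → lay x = P.layer (P.src e)) ∧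
      ∀ x y, lay x = lay y → lay x < P.len → x = y := by
  classical
  set lay : σ → ℕ := fun x =>
    if h : ∃ e, P.IsLive cut τ e ∧ P.label e = Sum.inl x then P.layer (P.src h.choose) else P.len
  have lay_eq (e x) (he : P.IsLive cut τ e) (hx : P.label e = Sum.inl x) :
      lay x = P.layer (P.src e) := by
    have h : ∃ e, P.IsLive cut τ e ∧ P.label e = Sum.inl x := ⟨e, he, hx⟩
    obtain ⟨hlive, hlabel⟩ := h.choose_spec
    simp only [lay, dif_pos h]
    exact congr_arg Fin.val (le_antisymm (he.layer_src_le hP hv hcut hlive hx hlabel)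
      (hlive.layer_src_le hP hv hcut he hlabel hx))
  have reads (x) (hx : lay x < P.len) : v ⟨lay x, hx⟩ = some x := by
    by_cases h : ∃ e, P.IsLive cut τ e ∧ P.label e = Sum.inl x
    · obtain ⟨e, he, hlabel⟩ := h
      obtain ⟨i, hi, hvi⟩ := he.exists_reads hv hlabel
      rw [← hvi]
      congr 1
      ext
      simp [lay_eq e x he hlabel, hi]
    · simp [lay, dif_neg h] at hx
  refine ⟨lay, lay_eq, fun x y hxy hx => ?_⟩
  have hy := reads y (hxy ▸ hx)
  simp only [← hxy, reads x hx] at hy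
  exact Option.some.inj hy

theorem IsPath.comp_cut_eq {u : Fin (P.len + 1) → Fin P.size} {e : Fin P.len → Fin P.numEdges}
    (h : P.IsPath u e) (hτ : ∃ p ∈ P.paths, p.1 ∘ cut = τ) (hlive : ∀ i, P.IsLive cut τ (e i)) :
    u ∘ cut = τ := by
  ext1 a
  rw [Function.comp_apply]
  cases hca : cut a using Fin.lastCases with
  | last =>
    obtain ⟨p, hp, rfl⟩ := hτ
    rw [Function.comp_apply, hca, h.2.1, (mem_paths.1 hp).2.1]
  | cast i =>
    obtain ⟨p, hp, rfl, i', hi'⟩ := hlive i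
    rw [mem_paths] at hp
    obtain rfl : i' = i := Fin.castSucc_injective _ (by
      rw [← hp.layer_src, ← h.layer_src, hi'])
    rw [Function.comp_apply, hca, ← (h.2.2 i').1, ← (hp.2.2 i').1, hi']

open Classical in
theorem sum_paths_comp_cut_eq [CommSemiring K] (hτ : ∃ p ∈ P.paths, p.1 ∘ cut = τ)
    (w : Fin P.numEdges → K) :
    ∑ p ∈ P.paths with p.1 ∘ cut = τ, ∏ i, w (p.2 i) =
      ∑ p ∈ P.paths, ∏ i, if P.IsLive cut τ (p.2 i) then w (p.2 i) else 0 := by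
  rw [sum_filter]
  refine sum_congr rfl fun p hp => ?_
  split_ifs with h
  · exact prod_congr rfl fun i _ => (if_pos ⟨p, hp, h, i, rfl⟩).symm
  · obtain ⟨i, hi⟩ : ∃ i, ¬P.IsLive cut τ (p.2 i) := by
      by_contra! hlive
      exact h ((mem_paths.1 hp).comp_cut_eq hτ hlive)
    exact (prod_eq_zero (mem_univ i) (if_neg hi)).symm

end Cuts

section Eval

variable [Field K] [DecidableEq σ]

theorem eval_poly (A : Finset σ) : MvPolynomial.eval (zeroOne K A) P.poly =
    ∑ p ∈ P.paths, ∏ i, MvPolynomial.eval (zeroOne K A) (P.edgePoly (p.2 i)) := by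
  simp only [poly, paths, map_sum, map_prod]

theorem eval_edgePoly_congr {e : Fin P.numEdges} {A A' : Finset σ}
    (h : ∀ x, P.label e = Sum.inl x → (x ∈ A ↔ x ∈ A')) :
    MvPolynomial.eval (zeroOne K A) (P.edgePoly e) =
      MvPolynomial.eval (zeroOne K A') (P.edgePoly e) := by
  rw [edgePoly]
  cases hlabel : P.label e with
  | inl x => simp [zeroOne, h x hlabel]
  | inr c => simp

end Eval

section RPass

variable [Field K] {N r b q : ℕ} {P : ABP (Fin N) K}

open Classical in
/-- Once the nodes of the cut layers are fixed the program is read-once: two paths that read the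
same variable in different layers could be spliced at a common node into one that reads it twice. -/
theorem exists_blocks_hasSplitRank_of_separatesReads (hP : P.IsSyntacticMultilinear)
    {v : Fin P.len → Option (Fin N)} (hv : P.Reads v) {cut : Fin r → Fin (P.len + 1)}
    (hcut : SeparatesReads v cut) (τ : Fin r → Fin P.size) (hb : 0 < b) (hN : q * b ≤ N) :
    ∃ blk : Fin N → Fin (q + 1), (∀ j : Fin q, #{x | blk x = j.castSucc} = b) ∧
      ∀ S, HasSplitRank S (P.size ^ (q + 1) * 2 ^ mixing S blk) fun A =>
        ∑ p ∈ P.paths with p.1 ∘ cut = τ,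
          ∏ i, MvPolynomial.eval (zeroOne K A) (P.edgePoly (p.2 i)) := by
  obtain ⟨lay, lay_eq, lay_inj⟩ := exists_layer_of_separatesReads hP hv hcut τ
  obtain ⟨blk, hmono, hcard⟩ := exists_blocks lay hb hN
  refine ⟨blk, hcard, fun S => ?_⟩
  by_cases hτ : ∃ p ∈ P.paths, p.1 ∘ cut = τ
  · set w : Finset (Fin N) → Fin P.numEdges → K := fun A e =>
      if P.IsLive cut τ e then MvPolynomial.eval (zeroOne K A) (P.edgePoly e) else 0
    have hrank := hasSplitRank_readOnce (T := fun A => P.layerMatrix (w A)) lay_inj ?_ hmono S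
      P.start P.term
    · have hsum (A) := sum_paths_comp_cut_eq hτ
        fun e => MvPolynomial.eval (zeroOne K A) (P.edgePoly e)
      simpa only [hsum, ← sum_paths_prod_eq, Fintype.card_fin] using hrank
    · intro i A A' hA
      ext a b
      simp only [layerMatrix, Matrix.of_apply]
      refine sum_congr rfl fun e he => ?_
      have hlayer := (mem_filter.1 he).2.1
      simp only [w]
      split_ifs with hlive
      · exact eval_edgePoly_congr fun x hx => hA x (by rw [lay_eq e x hlive hx, hlayer]; rfl)
      · rfl
  · rw [filter_false_of_mem fun p hp h => hτ ⟨p, hp, h⟩]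
    exact (HasSplitRank.const 0).mono
      (Nat.mul_pos (Nat.pow_pos P.start.pos) (Nat.two_pow_pos _))

theorem IsRPassMultilinear.exists_blocks_hasSplitRank (hP : P.IsRPassMultilinear r) (hb : 0 < b)
    (hN : q * b ≤ N) :
    ∃ blk : (Fin r → Fin P.size) → Fin N → Fin (q + 1),
      (∀ τ, ∀ j : Fin q, #{x | blk τ x = j.castSucc} = b) ∧
      ∀ S, HasSplitRank S (∑ τ, P.size ^ (q + 1) * 2 ^ mixing S (blk τ))
        fun A => MvPolynomial.eval (zeroOne K A) P.poly := by
  classical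
  obtain ⟨-, hml, π, v, hv, hsub⟩ := hP
  obtain ⟨cut, hcut⟩ :=
    exists_separatesReads (fun a => List.nodup_ofFn.2 (π a).injective) hsub
  choose blk hcard hrank using fun τ : Fin r → Fin P.size =>
    exists_blocks_hasSplitRank_of_separatesReads hml hv hcut τ hb hN
  refine ⟨blk, hcard, fun S => ?_⟩
  simp only [eval_poly, ← sum_fiberwise (s := P.paths) (g := fun p => p.1 ∘ cut)]
  exact HasSplitRank.sum fun τ => hrank τ S

end RPass

end ABP

end Passes

section LowerBound

open Finset

theorem ABP.hasSplitRank_one_of_size_le_one {σ K : Type*} [DecidableEq σ] [Field K]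
    {P : ABP σ K} (hP : P.size ≤ 1) (S : Finset σ) :
    HasSplitRank S 1 fun A => MvPolynomial.eval (zeroOne K A) P.poly := by
  have no_edges : IsEmpty (Fin P.numEdges) := ⟨fun e => by
    have same_layer := P.layer_tgt e
    rw [show P.tgt e = P.src e from Fin.ext (by omega)] at same_layer
    omega⟩
  have eval_const (A : Finset σ) : MvPolynomial.eval (zeroOne K A) P.poly =
      MvPolynomial.eval (zeroOne K ∅) P.poly := by
    rw [eval_poly, eval_poly]
    exact sum_congr rfl fun p _ => prod_congr rfl fun i _ => isEmptyElim (p.2 i)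
  simpa only [eval_const] using HasSplitRank.const _

section Counting

variable {F : Type*} [Field F] {N m : ℕ} {f : Fin m → MvPolynomial (Fin N) (RYField F N)}

theorem two_pow_le_sum_of_razYehudayoff_eq_sum (hg : razYehudayoff F N = ∑ j, f j)
    {S : Finset (Fin N)} (hS : 2 * #S = N) {T : Fin m → ℕ}
    (hT : ∀ j, HasSplitRank S (T j) fun A => MvPolynomial.eval (zeroOne (RYField F N) A) (f j)) :
    2 ^ #S ≤ ∑ j, T j := by
  refine two_pow_le_of_hasSplitRank_razYehudayoff F hS ?_
  simp only [hg, map_sum]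
  exact .sum hT

theorem two_pow_half_le_of_size_le_one (hg : razYehudayoff F N = ∑ j, f j) (hN : Even N)
    (hf : ∀ j, ∃ P : ABP (Fin N) (RYField F N), P.size ≤ 1 ∧ P.poly = f j) :
    2 ^ (N / 2) ≤ m := by
  obtain ⟨S, -, hS⟩ := exists_subset_card_eq (s := (univ : Finset (Fin N))) (n := N / 2)
    (by rw [card_univ, Fintype.card_fin]; exact Nat.div_le_self N 2)
  have le_sum := two_pow_le_sum_of_razYehudayoff_eq_sum hg (S := S) (T := fun _ => 1)
    (by rw [hS, Nat.two_mul_div_two_of_even hN]) fun j => by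
      obtain ⟨P, hP, hPj⟩ := hf j
      exact hPj ▸ ABP.hasSplitRank_one_of_size_le_one hP S
  simpa [hS] using le_sum

theorem card_sigma_fin_fun_le {r s : ℕ} {size : Fin m → ℕ} (hsize : ∀ j, size j ≤ s) :
    Fintype.card (Σ j, Fin r → Fin (size j)) ≤ m * s ^ r := by
  rw [Fintype.card_sigma]
  calc ∑ j, Fintype.card (Fin r → Fin (size j)) ≤ ∑ _j : Fin m, s ^ r := by
        refine sum_le_sum fun j _ => ?_
        rw [Fintype.card_fun, Fintype.card_fin, Fintype.card_fin]
        exact Nat.pow_le_pow_left (hsize j) r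
    _ = m * s ^ r := by rw [sum_const, card_univ, Fintype.card_fin, smul_eq_mul]

theorem two_pow_le_card_mul_of_two_pow_le_sum {ι : Type*} [Fintype ι] {n q h s : ℕ}
    {size μ : ι → ℕ} (hs : 2 * s ≤ 2 ^ h) (hsize : ∀ t, size t ≤ s) (hμ : ∀ t, μ t + q * h ≤ n)
    (hsum : 2 ^ n ≤ ∑ t, size t ^ (q + 1) * 2 ^ μ t) : 2 ^ q ≤ Fintype.card ι * s := by
  have term_le (t : ι) : size t ^ (q + 1) * 2 ^ μ t * 2 ^ q ≤ s * 2 ^ n :=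
    calc size t ^ (q + 1) * 2 ^ μ t * 2 ^ q ≤ s ^ (q + 1) * 2 ^ μ t * 2 ^ q := by
          gcongr
          exact hsize t
      _ = s * (2 ^ μ t * (2 * s) ^ q) := by ring
      _ ≤ s * (2 ^ μ t * (2 ^ h) ^ q) := by gcongr
      _ = s * 2 ^ (μ t + q * h) := by rw [← pow_mul, ← pow_add, mul_comm h]
      _ ≤ s * 2 ^ n := by
          gcongr
          · exact one_le_two
          · exact hμ t
  refine Nat.le_of_mul_le_mul_left (c := 2 ^ n) ?_ (by positivity)
  calc 2 ^ n * 2 ^ q ≤ ∑ t, size t ^ (q + 1) * 2 ^ μ t * 2 ^ q := by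
        rw [← sum_mul]
        exact Nat.mul_le_mul_right _ hsum
    _ ≤ ∑ _t : ι, s * 2 ^ n := sum_le_sum fun t _ => term_le t
    _ = 2 ^ n * (Fintype.card ι * s) := by rw [sum_const, card_univ, smul_eq_mul]; ring

theorem two_pow_le_of_razYehudayoff_eq_sum_rPass {r s h q : ℕ}
    (hg : razYehudayoff F N = ∑ j, f j) (hN : 0 < N) (hN' : Even N)
    (hf : ∀ j, ∃ P : ABP (Fin N) (RYField F N),
      P.IsRPassMultilinear r ∧ P.size ≤ s ∧ P.poly = f j)
    (hs : 0 < s) (hh : 0 < h) (hsh : 2 * s ≤ 2 ^ h) (hq : q * (2 * (128 * h ^ 2)) ≤ N) :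
    2 ^ q ≤ m * s ^ (r + 1) * N := by
  by_contra! hlt
  obtain ⟨n, rfl⟩ := even_iff_exists_two_mul.1 hN'
  choose P hP hsize hpoly using hf
  choose blk hcard hrank using fun j => (hP j).exists_blocks_hasSplitRank (by positivity) hq
  have card_le : Fintype.card (Σ j, Fin r → Fin (P j).size) ≤ m * s ^ r :=
    card_sigma_fin_fun_le hsize
  have few : Fintype.card (Σ j, Fin r → Fin (P j).size) * (2 * n) < 2 ^ q := by
    refine lt_of_le_of_lt (Nat.mul_le_mul_right _ (card_le.trans ?_)) hlt
    exact Nat.mul_le_mul_left _ (Nat.pow_le_pow_right hs r.le_succ)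
  obtain ⟨S, hS, hmix⟩ := exists_mixing_add_le (by omega) (by simp) hh
    (blk := fun t : Σ j, Fin r → Fin (P j).size => blk t.1 t.2) (fun t => hcard t.1 t.2) few
  have le_sum := two_pow_le_sum_of_razYehudayoff_eq_sum hg (by rw [hS])
    fun j => hpoly j ▸ hrank j S
  rw [hS, ← Fintype.sum_sigma'] at le_sum
  refine hlt.not_ge ?_
  calc 2 ^ q ≤ Fintype.card (Σ j, Fin r → Fin (P j).size) * s :=
        two_pow_le_card_mul_of_two_pow_le_sum hsh (fun t => hsize t.1) hmix le_sum
    _ ≤ m * s ^ r * s := Nat.mul_le_mul_right s card_le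
    _ = m * s ^ (r + 1) := by ring
    _ ≤ m * s ^ (r + 1) * (2 * n) := Nat.le_mul_of_pos_right _ hN

end Counting

section Asymptotics

open Real

variable {N s : ℕ}

theorem one_le_logb_two {x : ℝ} (hx : 2 ≤ x) : 1 ≤ logb 2 x := by
  rwa [le_logb_iff_rpow_le one_lt_two (by linarith), rpow_one]

theorem rpow_one_fifth_le_half_self (hN : 2 ≤ N) : 1 / 2 * (N : ℝ) ^ (1 / 5 : ℝ) ≤ N / 2 := by
  have hN' : (1 : ℝ) ≤ N := by exact_mod_cast (by omega : 1 ≤ N)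
  linarith [rpow_le_self_of_one_le hN' (by norm_num : (1 / 5 : ℝ) ≤ 1)]

theorem add_one_mul_sq_le_pow_five {x y : ℝ} (hx : 1 ≤ x) (hxy : 33 * x ≤ y) :
    (y + 1) * (256 * x ^ 2) ≤ y ^ 5 := by
  have hy : 1 ≤ y := by linarith
  have sq_le : 256 * x ^ 2 ≤ y ^ 2 / 2 := by nlinarith
  have two_le_five : y ^ 2 ≤ y ^ 5 := pow_le_pow_right₀ hy (by norm_num)
  have three_le_five : y ^ 3 ≤ y ^ 5 := pow_le_pow_right₀ hy (by norm_num)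
  calc (y + 1) * (256 * x ^ 2) ≤ (y + 1) * (y ^ 2 / 2) := by gcongr
    _ = (y ^ 3 + y ^ 2) / 2 := by ring
    _ ≤ y ^ 5 := by linarith

theorem exists_block_parameters (hs : 2 ≤ s)
    (hsN : 100 * logb 2 s ≤ (N : ℝ) ^ (1 / 5 : ℝ)) :
    ∃ h q : ℕ, 0 < h ∧ 2 * s ≤ 2 ^ h ∧ q * (2 * (128 * h ^ 2)) ≤ N ∧
      (N : ℝ) ^ (1 / 5 : ℝ) ≤ q := by
  have one_le_logb : 1 ≤ logb 2 (s : ℝ) := one_le_logb_two (by exact_mod_cast hs)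
  set h := Nat.clog 2 s + 1 with h_def
  have h_le : (h : ℝ) ≤ 3 * logb 2 s := by
    have ceil_lt : (Nat.clog 2 s : ℝ) < logb 2 s + 1 := by
      rw [← natCeil_logb_natCast]
      exact Nat.ceil_lt_add_one (by simpa using one_le_logb.trans' zero_le_one)
    rw [h_def]
    push_cast
    linarith
  refine ⟨h, N / (2 * (128 * h ^ 2)), Nat.succ_pos _, ?_, Nat.div_mul_le_self _ _, ?_⟩
  · rw [h_def, pow_succ']
    exact Nat.mul_le_mul_left 2 (Nat.le_pow_clog one_lt_two s)
  · have pow_five : ((N : ℝ) ^ (1 / 5 : ℝ)) ^ 5 = N := by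
      rw [← rpow_mul_natCast N.cast_nonneg]
      norm_num
    have le_div : (N : ℝ) ^ (1 / 5 : ℝ) + 1 ≤ (N : ℝ) / ((2 * (128 * h ^ 2) : ℕ) : ℝ) := by
      have one_le_h : (1 : ℝ) ≤ h := by exact_mod_cast Nat.succ_pos _
      have key := add_one_mul_sq_le_pow_five one_le_h (by linarith)
      rw [pow_five] at key
      rw [le_div_iff₀ (by positivity)]
      push_cast
      linarith
    have div_lt := Nat.lt_floor_add_one ((N : ℝ) / ((2 * (128 * h ^ 2) : ℕ) : ℝ))
    rw [Nat.floor_div_eq_div] at div_lt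
    linarith

theorem pow_mul_self_le_rpow (hN : 2 ≤ N) (hs : 2 ≤ s) (r : ℕ) :
    (s : ℝ) ^ (r + 1) * N ≤ (s : ℝ) ^ (100 * (r + logb 2 N)) := by
  have hN' : (2 : ℝ) ≤ N := by exact_mod_cast hN
  have hs' : (2 : ℝ) ≤ s := by exact_mod_cast hs
  have one_le_logb := one_le_logb_two hN'
  calc (s : ℝ) ^ (r + 1) * N = (s : ℝ) ^ (r + 1) * 2 ^ logb 2 N := by
        rw [rpow_logb two_pos (by norm_num) (by linarith)]
    _ ≤ (s : ℝ) ^ (r + 1) * (s : ℝ) ^ logb 2 N := by gcongr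
    _ = (s : ℝ) ^ (r + 1 + logb 2 N) := by
        rw [rpow_add (by linarith), ← rpow_natCast]
        push_cast
        rfl
    _ ≤ (s : ℝ) ^ (100 * (r + logb 2 N)) := by
        have : (0 : ℝ) ≤ r := r.cast_nonneg
        gcongr <;> linarith

theorem two_rpow_le_rpow_of_le_logb (hN : 2 ≤ N) (hs : 2 ≤ s) {y : ℝ} (hy : y ≤ 100 * logb 2 s)
    (r : ℕ) : (2 : ℝ) ^ y ≤ (s : ℝ) ^ (100 * (r + logb 2 N)) := by
  have hs' : (2 : ℝ) ≤ s := by exact_mod_cast hs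
  have one_le_logb := one_le_logb_two (x := N) (by exact_mod_cast hN)
  calc (2 : ℝ) ^ y ≤ 2 ^ (logb 2 s * 100) :=
        rpow_le_rpow_of_exponent_le one_le_two (by linarith)
    _ = (s : ℝ) ^ (100 : ℝ) := by
        rw [rpow_mul two_pos.le, rpow_logb two_pos (by norm_num) (two_pos.trans_le hs')]
    _ ≤ (s : ℝ) ^ (100 * (r + logb 2 N)) := by
        have : (0 : ℝ) ≤ r := r.cast_nonneg
        gcongr <;> linarith

theorem two_rpow_one_fifth_div_le (hN : 2 ≤ N) (hs : 2 ≤ s) {r m : ℕ}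
    (hcount : ∀ h q, 0 < h → 2 * s ≤ 2 ^ h → q * (2 * (128 * h ^ 2)) ≤ N →
      2 ^ q ≤ m * s ^ (r + 1) * N) :
    (2 : ℝ) ^ (1 / 2 * (N : ℝ) ^ (1 / 5 : ℝ)) / (s : ℝ) ^ (100 * (r + logb 2 N)) ≤ m := by
  have s_pos : (0 : ℝ) < s := by exact_mod_cast two_pos.trans_le hs
  have y_nonneg : 0 ≤ (N : ℝ) ^ (1 / 5 : ℝ) := by positivity
  rw [div_le_iff₀ (rpow_pos_of_pos s_pos _)]
  suffices (2 : ℝ) ^ (N : ℝ) ^ (1 / 5 : ℝ) ≤ m * (s : ℝ) ^ (100 * (r + logb 2 N)) from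
    (rpow_le_rpow_of_exponent_le one_le_two (by linarith)).trans this
  rcases le_or_gt ((N : ℝ) ^ (1 / 5 : ℝ)) (100 * logb 2 s) with h_small | h_large
  · have one_le_m : (1 : ℝ) ≤ m := by
      have two_mul_le : 2 * s ≤ 2 ^ (s + 1) := by
        rw [pow_succ']
        exact Nat.mul_le_mul_left 2 Nat.lt_two_pow_self.le
      rw [Nat.one_le_cast, Nat.one_le_iff_ne_zero]
      rintro rfl
      simpa using hcount (s + 1) 0 s.succ_pos two_mul_le (by simp)
    exact (two_rpow_le_rpow_of_le_logb hN hs h_small r).trans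
      (le_mul_of_one_le_left (by positivity) one_le_m)
  · obtain ⟨h, q, hh, hsh, hq, le_q⟩ := exists_block_parameters hs h_large.le
    calc (2 : ℝ) ^ (N : ℝ) ^ (1 / 5 : ℝ) ≤ 2 ^ (q : ℝ) :=
          rpow_le_rpow_of_exponent_le one_le_two le_q
      _ ≤ m * s ^ (r + 1) * N := by
          rw [rpow_natCast]
          exact_mod_cast hcount h q hh hsh hq
      _ = m * (s ^ (r + 1) * N) := mul_assoc _ _ _
      _ ≤ m * (s : ℝ) ^ (100 * (r + logb 2 N)) := by
          gcongr
          exact pow_mul_self_le_rpow hN hs r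

theorem two_rpow_one_fifth_div_le_of_size_le_one (hN : 2 ≤ N) (hN' : Even N) (hs : s ≤ 1)
    {r m : ℕ} (hm : 2 ^ (N / 2) ≤ m) :
    (2 : ℝ) ^ (1 / 2 * (N : ℝ) ^ (1 / 5 : ℝ)) / (s : ℝ) ^ (100 * (r + logb 2 N)) ≤ m := by
  have one_le_logb := one_le_logb_two (x := N) (by exact_mod_cast hN)
  have le_m : (2 : ℝ) ^ (1 / 2 * (N : ℝ) ^ (1 / 5 : ℝ)) ≤ m :=
    calc (2 : ℝ) ^ (1 / 2 * (N : ℝ) ^ (1 / 5 : ℝ)) ≤ 2 ^ ((N : ℝ) / 2) :=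
          rpow_le_rpow_of_exponent_le one_le_two (rpow_one_fifth_le_half_self hN)
      _ = 2 ^ (N / 2) := by
          rw [← rpow_natCast, Nat.cast_div hN'.two_dvd (by norm_num), Nat.cast_two]
      _ ≤ m := by exact_mod_cast hm
  interval_cases s
  · have exponent_ne_zero : 100 * (r + logb 2 N) ≠ 0 := by positivity
    rw [Nat.cast_zero, zero_rpow exponent_ne_zero, div_zero]
    exact m.cast_nonneg
  · rwa [Nat.cast_one, one_rpow, div_one]

end Asymptotics

end LowerBound

theorem mainTheorem2 :
    ∃ ε c : ℝ, 0 < ε ∧ 0 < c ∧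
      ∀ (F : Type*) [Field F] (N : ℕ), 0 < N → Even N →
        ∀ (r s m : ℕ) (f : Fin m → MvPolynomial (Fin N) (RYField F N)),
          (∀ j, ∃ P : ABP (Fin N) (RYField F N),
            P.IsRPassMultilinear r ∧ P.size ≤ s ∧ P.poly = f j) →
          razYehudayoff F N = ∑ j, f j →
          (2 : ℝ) ^ (ε * (N : ℝ) ^ (1 / 5 : ℝ)) / (s : ℝ) ^ (c * (r + Real.logb 2 N)) ≤ m := by
  refine ⟨1 / 2, 100, by norm_num, by norm_num, fun F _ N hN hev r s m f hf hg => ?_⟩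
  have two_le_N : 2 ≤ N := Nat.le_of_dvd hN hev.two_dvd
  rcases Nat.lt_or_ge s 2 with hs | hs
  · refine two_rpow_one_fifth_div_le_of_size_le_one two_le_N hev (by omega) ?_
    refine two_pow_half_le_of_size_le_one hg hev fun j => ?_
    obtain ⟨P, -, hsize, hpoly⟩ := hf j
    exact ⟨P, by omega, hpoly⟩
  · exact two_rpow_one_fifth_div_le two_le_N hs fun h q hh hsh hq =>
      two_pow_le_of_razYehudayoff_eq_sum_rPass hg hN hev hf (by omega) hh hsh hq
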